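/- Let $\Bbbk$ be a field of characteristic $0$. For $i=1,2$ let $E_i$ be a $\Sigma_2$-module, regarded as a space of binary operations, let $R_i\subseteq\mathcal F(E_i)(3)$ be a $\Sigma_3$-submodule of the arity-three component of the free operad on $E_i$, and let $\mathcal P_i=\mathcal F(E_i)/(R_i)$ be the corresponding quadratic operad. Put $E=E_1\oplus E_2$ and let $\mathcal F(E)(3)_{ij}\subseteq\mathcal F(E)(3)$ be the $\Sigma_3$-submodule generated by the compositions $\mu(1,\nu)$ and $\mu(\nu,1)$ with $\mu\in E_i$ and $\nu\in E_j$. For a linear map $$\mathcal D\colon \mathcal F(E)(3)_{12}\longrightarrow \mathcal F(E)(3)_{21}$$ put $R_{\mathcal D}=\{x-\mathcal D(x) : x\in\mathcal F(E)(3)_{12}\}$ and $\mathcal P=\mathcal F(E)/(R_1\oplus R_{\mathcal D}\oplus R_2)$. The map $\mathcal D$ is called a distributive law of $\mathcal P_1$ over $\mathcal P_2$ if it is $\Sigma_3$-equivariant and if, for every $n\ge 2$, the map $$\xi(n)\colon (\mathcal P_2\circ\mathcal P_1)(n)\longrightarrow\mathcal P(n),\qquad \mu\otimes(\nu_1\otimes\dots\otimes\nu_l)\longmapsto\mu(\nu_1,\dots,\nu_l),$$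 is an isomorphism; here $(\mathcal P_2\circ\mathcal P_1)(n)=\bigoplus_{\pi}\mathcal P_2[\pi]\otimes\bigotimes_{B\in\pi}\mathcal P_1[B]$, where the sum is over the partitions $\pi$ of $\{1,\dots,n\}$ into nonempty blocks $B$ and $\mathcal P_i[S]$ is the space of operations of $\mathcal P_i$ with inputs labelled by the finite set $S$. The law $\mathcal D=0$ is called trivial. Let $\mathcal Com$ be the quadratic operad generated by one commutative associative binary operation, and $\mathcal Lie$ the one generated by one antisymmetric binary operation that satisfies the Jacobi identity. **Theorem.** The only distributive law of $\mathcal Com$ over $\mathcal Com$ is the trivial one; that is, for $\mathcal P_1=\mathcal P_2=\mathcal Com$ a linear map $\mathcal D\colon\mathcal F(E)(3)_{12}\to\mathcal F(E)(3)_{21}$ is a distributive law if and only if $\mathcal D=0$. Dually, the only distributive law of $\mathcal Lie$ over $\mathcal Lie$ is the trivial one. -/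

import Mathlib

open scoped TensorProduct DirectSum

namespace DistLaw

universe u

/-- Planar binary trees whose vertices carry operation symbols from `C` and whose leaves are
labelled by `X`: the monomials in the binary operations `c ∈ C`. -/
inductive BTree (C X : Type) : Type
  | leaf (x : X) : BTree C X
  | node (c : C) (l r : BTree C X) : BTree C X

namespace BTree

variable {C C' X Y : Type}

/-- The multiset of leaf labels. -/
def leaves : BTree C X → Multiset X
  | leaf x => {x}
  | node _ l r => l.leaves + r.leaves

/-- Renaming the operation symbols. -/
def recolor (f : C → C') : BTree C X → BTree C' X
  | leaf x => leaf x
  | node c l r => node (f c) (l.recolor f) (r.recolor f)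

/-- Renaming the leaves. -/
def relabel (f : X → Y) : BTree C X → BTree C Y
  | leaf x => leaf (f x)
  | node c l r => node c (l.relabel f) (r.relabel f)

theorem leaves_recolor (f : C → C') (t : BTree C X) : (t.recolor f).leaves = t.leaves := by
  induction t with
  | leaf x => rfl
  | node c l r hl hr => simp [recolor, leaves, hl, hr]

theorem leaves_relabel (f : X → Y) (t : BTree C X) :
    (t.relabel f).leaves = t.leaves.map f := by
  induction t with
  | leaf x => simp [relabel, leaves]
  | node c l r hl hr => simp [relabel, leaves, hl, hr]

end BTree

/-- Formal linear combinations of trees. -/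
abbrev TreeMod (k : Type u) [Field k] (C X : Type) : Type u := BTree C X →₀ k

section Trees

variable {k : Type u} [Field k] {C C' X Y Z : Type}

/-- The bilinear extension of `(l, r) ↦ node c l r`. -/
noncomputable def graft (c : C) : TreeMod k C X →ₗ[k] TreeMod k C X →ₗ[k] TreeMod k C X :=
  Finsupp.linearCombination k fun l =>
    Finsupp.linearCombination k fun r => Finsupp.single (BTree.node c l r) (1 : k)

/-- Substitution of `s y` for the leaves labelled `y` of a tree. -/
noncomputable def evalTree (s : Y → TreeMod k C X) : BTree C Y → TreeMod k C X
  | BTree.leaf y => s y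
  | BTree.node c l r => graft c (evalTree s l) (evalTree s r)

/-- Substitution, extended linearly to combinations of trees. -/
noncomputable def subst (s : Y → TreeMod k C X) : TreeMod k C Y →ₗ[k] TreeMod k C X :=
  Finsupp.linearCombination k (evalTree s)

/-- Renaming the operation symbols, extended linearly. -/
noncomputable def recolorLin (f : C → C') : TreeMod k C X →ₗ[k] TreeMod k C' X :=
  Finsupp.lmapDomain k k (BTree.recolor f)

/-- The span of the trees whose multiset of leaf labels is `m`. If `m` is a finite set `S`, this is
the space of multilinear monomials in the elements of `S`, i.e. the component indexed by `S` of the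
free operad on binary operations `c ∈ C` without symmetry. -/
noncomputable def Homog (k : Type u) [Field k] (C : Type) {X : Type} (m : Multiset X) :
    Submodule k (TreeMod k C X) :=
  Finsupp.supported k k {t | t.leaves = m}

@[simp] theorem graft_single (c : C) (l r : BTree C X) (a b : k) :
    graft c (Finsupp.single l a) (Finsupp.single r b)
      = Finsupp.single (BTree.node c l r) (a * b) := by
  simp [graft]

@[simp] theorem subst_single (s : Y → TreeMod k C X) (t : BTree C Y) (a : k) :
    subst s (Finsupp.single t a) = a • evalTree s t := by
  simp [subst]

theorem single_mem_Homog {t : BTree C X} {m : Multiset X} (h : t.leaves = m) (a : k) :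
    Finsupp.single t a ∈ Homog k C m :=
  Finsupp.single_mem_supported k a h

theorem Homog_induction {m : Multiset X} {p : TreeMod k C X → Prop}
    (single : ∀ t : BTree C X, t.leaves = m → p (Finsupp.single t 1)) (zero : p 0)
    (add : ∀ x y, p x → p y → p (x + y)) (smul : ∀ (a : k) x, p x → p (a • x))
    {x : TreeMod k C X} (hx : x ∈ Homog k C m) : p x := by
  rw [Homog, Finsupp.supported_eq_span_single] at hx
  induction hx using Submodule.span_induction with
  | mem x h => obtain ⟨t, ht, rfl⟩ := h; exact single t ht
  | zero => exact zero
  | add x y _ _ hx hy => exact add x y hx hy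
  | smul a x _ hx => exact smul a x hx

theorem graft_mem {c : C} {a b : Multiset X} {x y : TreeMod k C X} (hx : x ∈ Homog k C a)
    (hy : y ∈ Homog k C b) : graft c x y ∈ Homog k C (a + b) := by
  refine Homog_induction (p := fun x => graft c x y ∈ Homog k C (a + b)) ?_ (by simp)
    (fun x x' h h' => by simpa using add_mem h h')
    (fun r x h => by simpa using Submodule.smul_mem _ r h) hx
  intro t ht
  refine Homog_induction (p := fun y => graft c _ y ∈ Homog k C (a + b)) ?_ (by simp)
    (fun x x' h h' => by simpa using add_mem h h')
    (fun r x h => by simpa using Submodule.smul_mem _ r h) hy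
  intro t' ht'
  rw [graft_single]
  exact single_mem_Homog (by simp [BTree.leaves, ht, ht']) _

theorem evalTree_mem {s : Y → TreeMod k C X} {d : Y → Multiset X}
    (hs : ∀ y, s y ∈ Homog k C (d y)) (t : BTree C Y) :
    evalTree s t ∈ Homog k C (t.leaves.bind d) := by
  induction t with
  | leaf y => simpa [evalTree, BTree.leaves] using hs y
  | node c l r hl hr => simpa [evalTree, BTree.leaves] using graft_mem hl hr

theorem subst_mem {s : Y → TreeMod k C X} {d : Y → Multiset X}
    (hs : ∀ y, s y ∈ Homog k C (d y)) {m : Multiset Y} {x : TreeMod k C Y}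
    (hx : x ∈ Homog k C m) : subst s x ∈ Homog k C (m.bind d) := by
  refine Homog_induction (p := fun x => subst s x ∈ Homog k C (m.bind d)) ?_ (by simp)
    (fun x x' h h' => by simpa using add_mem h h')
    (fun r x h => by simpa using Submodule.smul_mem _ r h) hx
  rintro t rfl
  simpa using evalTree_mem hs t

theorem subst_graft (s : Y → TreeMod k C X) (c : C) (x y : TreeMod k C Y) :
    subst s (graft c x y) = graft c (subst s x) (subst s y) := by
  induction x using Finsupp.induction_linear with
  | zero => simp
  | add x x' h h' => simp [h, h']
  | single t a =>
    induction y using Finsupp.induction_linear with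
    | zero => simp
    | add x x' h h' => simp [h, h']
    | single t' b => simp [evalTree, mul_smul, smul_comm a b, -Finsupp.single_mul]

theorem subst_subst (s : Y → TreeMod k C X) (u : Z → TreeMod k C Y) (x : TreeMod k C Z) :
    subst s (subst u x) = subst (fun z => subst s (u z)) x := by
  induction x using Finsupp.induction_linear with
  | zero => simp
  | add x x' h h' => simp [h, h']
  | single t a =>
    simp only [subst_single, map_smul]
    congr 1
    induction t with
    | leaf z => rfl
    | node c l r hl hr => simp [evalTree, subst_graft, hl, hr]

@[simp] theorem recolorLin_single (f : C → C') (t : BTree C X) (a : k) :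
    recolorLin f (Finsupp.single t a) = Finsupp.single (t.recolor f) a := by
  simp [recolorLin]

theorem recolorLin_mem (f : C → C') {m : Multiset X} {x : TreeMod k C X}
    (hx : x ∈ Homog k C m) : recolorLin f x ∈ Homog k C' m := by
  refine Homog_induction (p := fun x => recolorLin f x ∈ Homog k C' m) ?_ (by simp)
    (fun x x' h h' => by simpa using add_mem h h')
    (fun r x h => by simpa using Submodule.smul_mem _ r h) hx
  intro t ht
  rw [recolorLin_single]
  exact single_mem_Homog (by rw [BTree.leaves_recolor, ht]) _

theorem recolorLin_graft (f : C → C') (c : C) (x y : TreeMod k C X) :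
    recolorLin f (graft c x y) = graft (f c) (recolorLin f x) (recolorLin f y) := by
  induction x using Finsupp.induction_linear with
  | zero => simp
  | add x x' h h' => simp [h, h']
  | single t a =>
    induction y using Finsupp.induction_linear with
    | zero => simp
    | add x x' h h' => simp [h, h']
    | single t' b => simp [BTree.recolor, -Finsupp.single_mul]

theorem recolorLin_subst (f : C → C') (s : Y → TreeMod k C X) (x : TreeMod k C Y) :
    recolorLin f (subst s x) = subst (fun y => recolorLin f (s y)) (recolorLin f x) := by
  induction x using Finsupp.induction_linear with
  | zero => simp
  | add x x' h h' => simp [h, h']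
  | single t a =>
    simp only [subst_single, map_smul, recolorLin_single]
    congr 1
    induction t with
    | leaf z => rfl
    | node c l r hl hr => simp [evalTree, BTree.recolor, recolorLin_graft, hl, hr]

theorem evalTree_congr {s s' : Y → TreeMod k C X} {t : BTree C Y}
    (h : ∀ y ∈ t.leaves, s y = s' y) : evalTree s t = evalTree s' t := by
  induction t with
  | leaf y => exact h y (by simp [BTree.leaves])
  | node c l r hl hr =>
    simp only [evalTree]
    rw [hl fun y hy => h y (by simp [BTree.leaves, hy]),
      hr fun y hy => h y (by simp [BTree.leaves, hy])]

/-- Substitution into a tree without repeated leaves is linear in each argument. -/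
theorem evalTree_lin {s s₁ s₂ : Y → TreeMod k C X} {t : BTree C Y} (ht : t.leaves.Nodup) {y : Y}
    (hy : y ∈ t.leaves) (a b : k) (h₁ : ∀ z, z ≠ y → s z = s₁ z) (h₂ : ∀ z, z ≠ y → s z = s₂ z)
    (h : s y = a • s₁ y + b • s₂ y) :
    evalTree s t = a • evalTree s₁ t + b • evalTree s₂ t := by
  induction t with
  | leaf z =>
    obtain rfl : y = z := by simpa [BTree.leaves] using hy
    simpa [evalTree] using h
  | node c l r hl hr =>
    simp only [BTree.leaves, Multiset.nodup_add, Multiset.mem_add] at ht hy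
    obtain ⟨hnl, hnr, hd⟩ := ht
    simp only [evalTree]
    by_cases hyl : y ∈ l.leaves
    · have hyr : ∀ z ∈ r.leaves, z ≠ y := by
        rintro z hz rfl
        exact Multiset.disjoint_left.mp hd hyl hz
      rw [hl hnl hyl, evalTree_congr (fun z hz => (h₁ z (hyr z hz)).symm),
        evalTree_congr (s := s₂) (t := r) (fun z hz => (h₂ z (hyr z hz)).symm)]
      simp
    · have hyr : y ∈ r.leaves := hy.resolve_left hyl
      have hyl' : ∀ z ∈ l.leaves, z ≠ y := by
        rintro z hz rfl
        exact hyl hz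
      rw [hr hnr hyr, evalTree_congr (fun z hz => (h₁ z (hyl' z hz)).symm),
        evalTree_congr (s := s₂) (t := l) (fun z hz => (h₂ z (hyl' z hz)).symm)]
      simp

theorem subst_lin {s s₁ s₂ : Y → TreeMod k C X} {m : Multiset Y} (hm : m.Nodup) {y : Y}
    (hy : y ∈ m) (a b : k) (h₁ : ∀ z, z ≠ y → s z = s₁ z) (h₂ : ∀ z, z ≠ y → s z = s₂ z)
    (h : s y = a • s₁ y + b • s₂ y) {x : TreeMod k C Y} (hx : x ∈ Homog k C m) :
    subst s x = a • subst s₁ x + b • subst s₂ x := by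
  refine Homog_induction (p := fun x => subst s x = a • subst s₁ x + b • subst s₂ x) ?_
    (by simp) (fun x x' h h' => by simp only [map_add, h, h', smul_add]; abel)
    (fun r x h => by simp only [map_smul, h, smul_add, smul_comm r]) hx
  rintro t rfl
  simpa using evalTree_lin hm hy a b h₁ h₂ h

/-! ### Operads given by generators and relations -/

/-- Let `E` be the `Σ₂`-module with basis `C` on which the transposition acts by `c ↦ ε(c) c`, and
let `R` be a set of multilinear relations in three variables. `IdealMem ε R S x` says that `x` lies
in the component at the finite set `S` of the operadic ideal generated by the symmetries
`c(x, y) = ε(c) c(y, x)` and by `R` in the free operad on the binary operations `c ∈ C` without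
symmetry. This ideal is the smallest family of subspaces which contains the elements obtained by
substituting arbitrary elements with disjoint sets of leaves for the variables of a symmetry or of a
relation in `R`, and which is closed under grafting arbitrary elements with disjoint sets of leaves.

The index is a multiset only for convenience: the index of a composite is the sum of those of its
parts, so if it is a set, then it is the disjoint union of theirs. -/
inductive IdealMem (ε : C → ℤˣ) (R : Set (TreeMod k C (Fin 3))) :
    Multiset X → TreeMod k C X → Prop
  | symm (c : C) {a b : Multiset X} (x : Homog k C a) (y : Homog k C b) :
      IdealMem ε R (a + b) (graft c x.1 y.1 - ((ε c : ℤ) : k) • graft c y.1 x.1)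
  | rel {r : TreeMod k C (Fin 3)} (hr : r ∈ R) (d : Fin 3 → Multiset X)
      (s : ∀ i, Homog k C (d i)) :
      IdealMem ε R (d 0 + d 1 + d 2) (subst (fun i => (s i).1) r)
  | graft_left (c : C) {a b : Multiset X} {x : TreeMod k C X} (hx : IdealMem ε R a x)
      (y : Homog k C b) : IdealMem ε R (a + b) (graft c x y.1)
  | graft_right (c : C) {a b : Multiset X} {y : TreeMod k C X} (x : Homog k C a)
      (hy : IdealMem ε R b y) : IdealMem ε R (a + b) (graft c x.1 y)
  | zero (a : Multiset X) : IdealMem ε R a 0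
  | add {a : Multiset X} {x y : TreeMod k C X} (hx : IdealMem ε R a x) (hy : IdealMem ε R a y) :
      IdealMem ε R a (x + y)
  | smul {a : Multiset X} (r : k) {x : TreeMod k C X} (hx : IdealMem ε R a x) :
      IdealMem ε R a (r • x)

/-- The component at the finite set `S` of the free operad on the binary operations `c ∈ C`
without symmetry. -/
def Comp (k : Type u) [Field k] (C : Type) {X : Type} (S : Finset X) : Type u :=
  Homog k C S.val

noncomputable instance (S : Finset X) : AddCommGroup (Comp k C S) :=
  inferInstanceAs (AddCommGroup (Homog k C S.val))

noncomputable instance (S : Finset X) : Module k (Comp k C S) :=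
  inferInstanceAs (Module k (Homog k C S.val))

/-- The inclusion of a component into the space of all combinations of trees. -/
noncomputable def Comp.val {S : Finset X} : Comp k C S →ₗ[k] TreeMod k C X where
  toFun x := Subtype.val x
  map_add' _ _ := rfl
  map_smul' _ _ := rfl

/-- The element of a component given by a combination of trees. -/
def Comp.mk {S : Finset X} (x : TreeMod k C X) (hx : x ∈ Homog k C S.val) : Comp k C S := ⟨x, hx⟩

@[simp] theorem Comp.val_mk {S : Finset X} (x : TreeMod k C X) (hx : x ∈ Homog k C S.val) :
    (Comp.mk x hx).val = x := rfl

theorem Comp.val_mem {S : Finset X} (x : Comp k C S) : x.val ∈ Homog k C S.val := x.2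

theorem Comp.ext {S : Finset X} {x y : Comp k C S} (h : x.val = y.val) : x = y := Subtype.ext h

/-- A linear map of tree spaces that preserves the components indexed by `S` and `T`. -/
noncomputable def Comp.restrict {S : Finset X} {T : Finset Y}
    (f : TreeMod k C X →ₗ[k] TreeMod k C' Y)
    (hf : ∀ x ∈ Homog k C S.val, f x ∈ Homog k C' T.val) : Comp k C S →ₗ[k] Comp k C' T where
  toFun x := Comp.mk (f x.val) (hf _ x.val_mem)
  map_add' x y := Comp.ext (by simp)
  map_smul' r x := Comp.ext (by simp)

/-- The component at `S` of the operadic ideal generated by the symmetries `ε` and by `R`. -/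
noncomputable def ideal (ε : C → ℤˣ) (R : Set (TreeMod k C (Fin 3))) (S : Finset X) :
    Submodule k (Comp k C S) where
  carrier := {x | IdealMem ε R S.val x.val}
  zero_mem' := by simpa using IdealMem.zero _
  add_mem' hx hy := by simpa using IdealMem.add hx hy
  smul_mem' r _ hx := by simpa using IdealMem.smul r hx

/-- The component at the finite set `S` of the operad with generators `C` of symmetry `ε` and
relations `R`. For `R = ∅` this is the free operad `F(E)` on the `Σ₂`-module `E` with basis `C` on
which the transposition acts by `c ↦ ε(c) c`. The component in arity `n` is the one at `Finset.univ : Finset (Fin n)`. -/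
def Op (ε : C → ℤˣ) (R : Set (TreeMod k C (Fin 3))) (S : Finset X) : Type u :=
  Comp k C S ⧸ ideal ε R S

noncomputable instance (ε : C → ℤˣ) (R : Set (TreeMod k C (Fin 3))) (S : Finset X) :
    AddCommGroup (Op ε R S) :=
  inferInstanceAs (AddCommGroup (Comp k C S ⧸ ideal ε R S))

noncomputable instance (ε : C → ℤˣ) (R : Set (TreeMod k C (Fin 3))) (S : Finset X) :
    Module k (Op ε R S) :=
  inferInstanceAs (Module k (Comp k C S ⧸ ideal ε R S))

/-- The quotient map onto the component of the operad. -/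
noncomputable def Op.mk (ε : C → ℤˣ) (R : Set (TreeMod k C (Fin 3))) (S : Finset X) :
    Comp k C S →ₗ[k] Op ε R S :=
  (ideal ε R S).mkQ

theorem Op.mk_surjective (ε : C → ℤˣ) (R : Set (TreeMod k C (Fin 3))) (S : Finset X) :
    Function.Surjective (Op.mk ε R S) :=
  (ideal ε R S).mkQ_surjective

theorem Op.mk_eq_zero {ε : C → ℤˣ} {R : Set (TreeMod k C (Fin 3))} {S : Finset X}
    {x : Comp k C S} : Op.mk ε R S x = 0 ↔ x ∈ ideal ε R S :=
  Submodule.Quotient.mk_eq_zero _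

/-- The linear map on a component of the operad induced by one that kills the ideal. -/
noncomputable def Op.lift {N : Type*} [AddCommGroup N] [Module k N] {ε : C → ℤˣ}
    {R : Set (TreeMod k C (Fin 3))} {S : Finset X} (f : Comp k C S →ₗ[k] N)
    (hf : ∀ x ∈ ideal ε R S, f x = 0) : Op ε R S →ₗ[k] N :=
  (ideal ε R S).liftQ f hf

@[simp] theorem Op.lift_mk {N : Type*} [AddCommGroup N] [Module k N] {ε : C → ℤˣ}
    {R : Set (TreeMod k C (Fin 3))} {S : Finset X} (f : Comp k C S →ₗ[k] N)
    (hf : ∀ x ∈ ideal ε R S, f x = 0) (x : Comp k C S) : Op.lift f hf (Op.mk ε R S x) = f x :=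
  rfl

/-- The class of a tree. -/
noncomputable def ofTree (ε : C → ℤˣ) (R : Set (TreeMod k C (Fin 3))) (S : Finset X)
    (t : BTree C X) (h : t.leaves = S.val) : Op ε R S :=
  Op.mk ε R S (Comp.mk (Finsupp.single t 1) (single_mem_Homog h 1))

theorem evalTree_idealMem {ε : C → ℤˣ} {R : Set (TreeMod k C (Fin 3))} {s : Y → TreeMod k C X}
    {d : Y → Multiset X} (hs : ∀ y, s y ∈ Homog k C (d y)) {t : BTree C Y} {y : Y}
    (hy : y ∈ t.leaves) (h : IdealMem ε R (d y) (s y)) :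
    IdealMem ε R (t.leaves.bind d) (evalTree s t) := by
  induction t with
  | leaf z =>
    obtain rfl : y = z := by simpa [BTree.leaves] using hy
    simpa [evalTree, BTree.leaves] using h
  | node c l r hl hr =>
    simp only [BTree.leaves, Multiset.mem_add] at hy
    simp only [evalTree, BTree.leaves, Multiset.add_bind]
    rcases hy with hy | hy
    · exact IdealMem.graft_left c (hl hy) ⟨_, evalTree_mem hs r⟩
    · exact IdealMem.graft_right c ⟨_, evalTree_mem hs l⟩ (hr hy)

theorem subst_idealMem_right {ε : C → ℤˣ} {R : Set (TreeMod k C (Fin 3))}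
    {s : Y → TreeMod k C X} {d : Y → Multiset X} (hs : ∀ y, s y ∈ Homog k C (d y))
    {m : Multiset Y} {y : Y} (hy : y ∈ m) (h : IdealMem ε R (d y) (s y)) {x : TreeMod k C Y}
    (hx : x ∈ Homog k C m) : IdealMem ε R (m.bind d) (subst s x) := by
  refine Homog_induction (p := fun x => IdealMem ε R (m.bind d) (subst s x)) ?_
    (by simpa using IdealMem.zero _) (fun x x' h h' => by simpa using IdealMem.add h h')
    (fun r x h => by simpa using IdealMem.smul r h) hx
  rintro t rfl
  simpa using evalTree_idealMem hs hy h

theorem subst_idealMem_left {ε : C → ℤˣ} {R : Set (TreeMod k C (Fin 3))}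
    {s : Y → TreeMod k C X} {d : Y → Multiset X} (hs : ∀ y, s y ∈ Homog k C (d y))
    {m : Multiset Y} {x : TreeMod k C Y} (hx : IdealMem ε R m x) :
    IdealMem ε R (m.bind d) (subst s x) := by
  induction hx with
  | symm c x y =>
    simpa [subst_graft] using IdealMem.symm (ε := ε) (R := R) c ⟨_, subst_mem hs x.2⟩
      ⟨_, subst_mem hs y.2⟩
  | rel hr e u =>
    rw [subst_subst]
    simpa using IdealMem.rel (ε := ε) hr (fun i => (e i).bind d)
      (fun i => ⟨_, subst_mem hs (u i).2⟩)
  | graft_left c hx y ih =>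
    simpa [subst_graft] using IdealMem.graft_left c ih ⟨_, subst_mem hs y.2⟩
  | graft_right c x hy ih =>
    simpa [subst_graft] using IdealMem.graft_right c ⟨_, subst_mem hs x.2⟩ ih
  | zero => simpa using IdealMem.zero _
  | add _ _ h h' => simpa using IdealMem.add h h'
  | smul r _ h => simpa using IdealMem.smul r h

theorem recolor_idealMem {f : C → C'} {ε : C → ℤˣ} {ε' : C' → ℤˣ} (hε : ∀ c, ε' (f c) = ε c)
    {R : Set (TreeMod k C (Fin 3))} {R' : Set (TreeMod k C' (Fin 3))}
    (hR : ∀ r ∈ R, recolorLin f r ∈ R') {m : Multiset X} {x : TreeMod k C X}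
    (hx : IdealMem ε R m x) : IdealMem ε' R' m (recolorLin f x) := by
  induction hx with
  | symm c x y =>
    simpa [recolorLin_graft, hε] using IdealMem.symm (ε := ε') (R := R') (f c)
      ⟨_, recolorLin_mem f x.2⟩ ⟨_, recolorLin_mem f y.2⟩
  | rel hr e u =>
    rw [recolorLin_subst]
    exact IdealMem.rel (hR _ hr) e (fun i => ⟨_, recolorLin_mem f (u i).2⟩)
  | graft_left c hx y ih =>
    simpa [recolorLin_graft] using IdealMem.graft_left (f c) ih ⟨_, recolorLin_mem f y.2⟩
  | graft_right c x hy ih =>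
    simpa [recolorLin_graft] using IdealMem.graft_right (f c) ⟨_, recolorLin_mem f x.2⟩ ih
  | zero => simpa using IdealMem.zero _
  | add _ _ h h' => simpa using IdealMem.add h h'
  | smul r _ h => simpa using IdealMem.smul r h

/-- The operad morphism induced by a map of generators that carries relations to relations. -/
noncomputable def recolorOp (f : C → C') {ε : C → ℤˣ} {ε' : C' → ℤˣ} (hε : ∀ c, ε' (f c) = ε c)
    {R : Set (TreeMod k C (Fin 3))} {R' : Set (TreeMod k C' (Fin 3))}
    (hR : ∀ r ∈ R, recolorLin f r ∈ R') (S : Finset X) : Op ε R S →ₗ[k] Op ε' R' S :=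
  Op.lift (Op.mk ε' R' S ∘ₗ Comp.restrict (recolorLin f) fun _ hx => recolorLin_mem f hx)
    fun _ hx => Op.mk_eq_zero.mpr (recolor_idealMem hε hR hx)

theorem bind_perm {n : ℕ} (σ : Equiv.Perm (Fin n)) :
    ((Finset.univ : Finset (Fin n)).val.bind fun i => {σ i}) = Finset.univ.val := by
  rw [Multiset.bind_singleton]
  simp

theorem leaf_mem (σ : X → Y) (i : X) :
    (Finsupp.single (BTree.leaf (σ i)) 1 : TreeMod k C Y) ∈ Homog k C {σ i} :=
  single_mem_Homog rfl 1

/-- Renaming the leaf `i` to `σ i` in the component of arity `n`. -/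
noncomputable def actComp {n : ℕ} (σ : Equiv.Perm (Fin n)) :
    Comp k C (Finset.univ : Finset (Fin n)) →ₗ[k] Comp k C (Finset.univ : Finset (Fin n)) :=
  Comp.restrict (subst fun i => Finsupp.single (BTree.leaf (σ i)) 1)
    fun _ hx => by simpa only [bind_perm] using subst_mem (leaf_mem (k := k) (C := C) σ) hx

theorem actComp_mem (ε : C → ℤˣ) (R : Set (TreeMod k C (Fin 3))) {n : ℕ}
    (σ : Equiv.Perm (Fin n)) {x : Comp k C (Finset.univ : Finset (Fin n))}
    (hx : x ∈ ideal ε R Finset.univ) : actComp σ x ∈ ideal ε R Finset.univ := by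
  have := subst_idealMem_left (leaf_mem (k := k) (C := C) σ) (show IdealMem ε R _ x.val from hx)
  rw [bind_perm] at this
  exact this

/-- The action of `σ ∈ Σₙ` on the arity `n` component of an operad: the leaf `i` is renamed
to `σ i`. -/
noncomputable def act (ε : C → ℤˣ) (R : Set (TreeMod k C (Fin 3))) {n : ℕ}
    (σ : Equiv.Perm (Fin n)) :
    Op ε R (Finset.univ : Finset (Fin n)) →ₗ[k] Op ε R (Finset.univ : Finset (Fin n)) :=
  Op.lift (Op.mk ε R Finset.univ ∘ₗ actComp σ) fun _ hx => Op.mk_eq_zero.mpr (actComp_mem ε R σ hx)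

theorem act_ofTree (ε : C → ℤˣ) (R : Set (TreeMod k C (Fin 3))) {n : ℕ} (σ : Equiv.Perm (Fin n))
    (t : BTree C (Fin n)) (h : t.leaves = Finset.univ.val) :
    ∃ h', act ε R σ (ofTree ε R Finset.univ t h) = ofTree ε R Finset.univ (t.relabel σ) h' := by
  have h' : (t.relabel σ).leaves = (Finset.univ : Finset (Fin n)).val := by
    rw [BTree.leaves_relabel, h, ← Multiset.bind_singleton, bind_perm]
  refine ⟨h', ?_⟩
  unfold act ofTree
  rw [Op.lift_mk, LinearMap.comp_apply]
  congr 1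
  apply Comp.ext
  change subst _ (Finsupp.single t 1) = Finsupp.single (t.relabel σ) 1
  rw [subst_single, one_smul]
  clear h h'
  induction t with
  | leaf i => rfl
  | node c l r hl hr => simp [evalTree, BTree.relabel, hl, hr]

end Trees

/-! ### Operadic composition along a set partition -/

/-- A multilinear map that vanishes as soon as one argument lies in `p i` depends only on the classes
of its arguments modulo the `p i`. -/
theorem multilinear_congr {k : Type*} [Field k] {ι : Type*} [Fintype ι] {M : ι → Type*} {N : Type*}
    [∀ i, AddCommGroup (M i)] [∀ i, Module k (M i)] [AddCommGroup N] [Module k N]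
    (f : MultilinearMap k M N) (p : ∀ i, Submodule k (M i))
    (h : ∀ i s, s i ∈ p i → f s = 0) {s s' : ∀ i, M i} (hs : ∀ i, s i - s' i ∈ p i) :
    f s = f s' := by
  classical
  have key : ∀ T : Finset ι, f (T.piecewise s s') = f s' := by
    intro T
    induction T using Finset.induction_on with
    | empty => simp
    | insert i T hi ih =>
      rw [Finset.piecewise_insert, ← ih, ← sub_eq_zero]
      have e : T.piecewise s s' = Function.update (T.piecewise s s') i (s' i) := by
        conv_lhs => rw [← Function.update_eq_self i (T.piecewise s s')]
        simp [hi]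
      conv_lhs => rw [e]
      rw [Function.update_idem, ← MultilinearMap.map_update_sub]
      exact h i _ (by simpa using hs i)
  simpa using key Finset.univ

/-- Representatives of a family of classes. -/
noncomputable def quotRep {k : Type*} [Field k] {ι : Type*} {M : ι → Type*}
    [∀ i, AddCommGroup (M i)] [∀ i, Module k (M i)] {p : ∀ i, Submodule k (M i)}
    (q : ∀ i, M i ⧸ p i) (i : ι) : M i :=
  ((p i).mkQ_surjective (q i)).choose

theorem mkQ_quotRep {k : Type*} [Field k] {ι : Type*} {M : ι → Type*}
    [∀ i, AddCommGroup (M i)] [∀ i, Module k (M i)] {p : ∀ i, Submodule k (M i)}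
    (q : ∀ i, M i ⧸ p i) (i : ι) : (p i).mkQ (quotRep q i) = q i :=
  ((p i).mkQ_surjective (q i)).choose_spec

theorem descend_aux {k : Type*} [Field k] {ι : Type*} [Fintype ι] [DecidableEq ι] {M : ι → Type*}
    {N : Type*} [∀ i, AddCommGroup (M i)] [∀ i, Module k (M i)] [AddCommGroup N] [Module k N]
    (p : ∀ i, Submodule k (M i)) (f : MultilinearMap k M N)
    (h : ∀ i s, s i ∈ p i → f s = 0) (q : ∀ i, M i ⧸ p i) (i : ι) (c : M i) :
    f (quotRep (Function.update q i ((p i).mkQ c))) = f (Function.update (quotRep q) i c) := by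
  refine multilinear_congr f p h fun j => ?_
  rw [← Submodule.ker_mkQ (p j), LinearMap.mem_ker, map_sub, mkQ_quotRep, sub_eq_zero]
  rcases eq_or_ne j i with rfl | hj
  · simp
  · simp only [Function.update_of_ne hj, mkQ_quotRep]

/-- The multilinear map on quotients induced by `f`. -/
noncomputable def multilinearDescend {k : Type*} [Field k] {ι : Type*} [Fintype ι] {M : ι → Type*}
    {N : Type*} [∀ i, AddCommGroup (M i)] [∀ i, Module k (M i)] [AddCommGroup N] [Module k N]
    (p : ∀ i, Submodule k (M i)) (f : MultilinearMap k M N)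
    (h : ∀ i s, s i ∈ p i → f s = 0) : MultilinearMap k (fun i => M i ⧸ p i) N where
  toFun q := f (quotRep q)
  map_update_add' q i a b := by
    obtain ⟨a, rfl⟩ := (p i).mkQ_surjective a
    obtain ⟨b, rfl⟩ := (p i).mkQ_surjective b
    rw [← map_add, descend_aux p f h, descend_aux p f h, descend_aux p f h, f.map_update_add]
  map_update_smul' q i r a := by
    obtain ⟨a, rfl⟩ := (p i).mkQ_surjective a
    rw [← map_smul, descend_aux p f h, descend_aux p f h, f.map_update_smul]

theorem multilinearDescend_mk {k : Type*} [Field k] {ι : Type*} [Fintype ι] {M : ι → Type*}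
    {N : Type*} [∀ i, AddCommGroup (M i)] [∀ i, Module k (M i)] [AddCommGroup N] [Module k N]
    (p : ∀ i, Submodule k (M i)) (f : MultilinearMap k M N)
    (h : ∀ i s, s i ∈ p i → f s = 0) (s : ∀ i, M i) :
    multilinearDescend p f h (fun i => (p i).mkQ (s i)) = f s := by
  refine multilinear_congr f p h fun j => ?_
  rw [← Submodule.ker_mkQ (p j), LinearMap.mem_ker, map_sub, mkQ_quotRep, sub_self]

section Composition

variable {k : Type u} [Field k] {C X : Type} [DecidableEq X] {S : Finset X}

/-- A family indexed by the blocks of a partition, extended by zero. -/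
noncomputable def blockFun (π : Finpartition S) (s : ∀ B : π.parts, Comp k C B.1)
    (B : Finset X) : TreeMod k C X :=
  if h : B ∈ π.parts then (s ⟨B, h⟩).val else 0

theorem blockFun_coe (π : Finpartition S) (s : ∀ B : π.parts, Comp k C B.1) (B : π.parts) :
    blockFun π s B.1 = (s B).val := by
  simp [blockFun]

theorem blockFun_mem (π : Finpartition S) (s : ∀ B : π.parts, Comp k C B.1) (B : Finset X) :
    blockFun π s B ∈ Homog k C B.val := by
  unfold blockFun
  split_ifs with h
  · exact (s ⟨B, h⟩).val_mem
  · exact zero_mem _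

theorem bind_parts (π : Finpartition S) : (π.parts.val.bind fun B => B.val) = S.val := by
  conv_rhs => rw [← π.biUnion_parts, ← Finset.disjiUnion_eq_biUnion _ _ π.disjoint,
    Finset.disjiUnion_val]
  rfl

/-- Operadic composition `(t, (s_B)_B) ↦ t(s_B)_B` along a set partition `π` of `S`, for
combinations of trees: the tree `s_B` is grafted onto the leaf of `t` labelled by the block `B`. -/
noncomputable def gammaComp (π : Finpartition S) (x : Comp k C π.parts) :
    MultilinearMap k (fun B : π.parts => Comp k C B.1) (Comp k C S) where
  toFun s := Comp.mk (subst (blockFun π s) x.val) (by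
    simpa only [bind_parts] using subst_mem (blockFun_mem π s) x.val_mem)
  map_update_add' s B a b := by
    apply Comp.ext
    simp only [Comp.val_mk, map_add]
    have h := subst_lin (k := k) (s := blockFun π (Function.update s B (a + b)))
      (s₁ := blockFun π (Function.update s B a)) (s₂ := blockFun π (Function.update s B b))
      π.parts.nodup B.2 1 1 ?_ ?_ ?_ x.val_mem
    · simpa using h
    · intro z hz
      unfold blockFun
      split_ifs with h
      · rw [Function.update_of_ne, Function.update_of_ne] <;> exact fun e => hz (by rw [← e])
      · rfl
    · intro z hz
      unfold blockFun
      split_ifs with h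
      · rw [Function.update_of_ne, Function.update_of_ne] <;> exact fun e => hz (by rw [← e])
      · rfl
    · simp [blockFun_coe]
  map_update_smul' s B r a := by
    apply Comp.ext
    simp only [Comp.val_mk, map_smul]
    have h := subst_lin (k := k) (s := blockFun π (Function.update s B (r • a)))
      (s₁ := blockFun π (Function.update s B a)) (s₂ := blockFun π (Function.update s B a))
      π.parts.nodup B.2 r 0 ?_ ?_ ?_ x.val_mem
    · simpa using h
    · intro z hz
      unfold blockFun
      split_ifs with h
      · rw [Function.update_of_ne, Function.update_of_ne] <;> exact fun e => hz (by rw [← e])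
      · rfl
    · intro z hz
      unfold blockFun
      split_ifs with h
      · rw [Function.update_of_ne, Function.update_of_ne] <;> exact fun e => hz (by rw [← e])
      · rfl
    · simp [blockFun_coe]

theorem gammaComp_mem_left (ε : C → ℤˣ) (R : Set (TreeMod k C (Fin 3))) (π : Finpartition S)
    {x : Comp k C π.parts} (hx : x ∈ ideal ε R π.parts) (s : ∀ B : π.parts, Comp k C B.1) :
    gammaComp π x s ∈ ideal ε R S := by
  have := subst_idealMem_left (blockFun_mem π s) (show IdealMem ε R _ x.val from hx)
  rw [bind_parts] at this
  exact this

theorem gammaComp_mem_right (ε : C → ℤˣ) (R : Set (TreeMod k C (Fin 3))) (π : Finpartition S)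
    (x : Comp k C π.parts) (B : π.parts) (s : ∀ B : π.parts, Comp k C B.1)
    (hs : s B ∈ ideal ε R B.1) : gammaComp π x s ∈ ideal ε R S := by
  have := subst_idealMem_right (ε := ε) (R := R) (blockFun_mem π s) B.2
    (by rw [blockFun_coe]; exact hs) x.val_mem
  rw [bind_parts] at this
  exact this

theorem mk_gammaComp_eq_zero (ε : C → ℤˣ) (R : Set (TreeMod k C (Fin 3))) (π : Finpartition S)
    (x : Comp k C π.parts) (B : π.parts) (s : ∀ B : π.parts, Comp k C B.1)
    (hs : s B ∈ ideal ε R B.1) : (Op.mk ε R S).compMultilinearMap (gammaComp π x) s = 0 :=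
  Op.mk_eq_zero.mpr (gammaComp_mem_right ε R π x B s hs)

/-- Operadic composition `P[π] × ∏_{B ∈ π} P[B] → P[S]` along a set partition `π` of `S`, as a
function of the second argument. -/
noncomputable def gammaAux (ε : C → ℤˣ) (R : Set (TreeMod k C (Fin 3))) (π : Finpartition S)
    (x : Comp k C π.parts) :
    MultilinearMap k (fun B : π.parts => Op ε R B.1) (Op ε R S) :=
  multilinearDescend (fun B : π.parts => ideal ε R B.1)
    ((Op.mk ε R S).compMultilinearMap (gammaComp π x)) (mk_gammaComp_eq_zero ε R π x)

theorem gammaAux_apply (ε : C → ℤˣ) (R : Set (TreeMod k C (Fin 3))) (π : Finpartition S)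
    (x : Comp k C π.parts) (q : ∀ B : π.parts, Op ε R B.1) :
    gammaAux ε R π x q
      = Op.mk ε R S (gammaComp π x (quotRep (p := fun B : π.parts => ideal ε R B.1) q)) := rfl

/-- Operadic composition `P[π] × ∏_{B ∈ π} P[B] → P[S]` along a set partition `π` of `S`. -/
noncomputable def gamma (ε : C → ℤˣ) (R : Set (TreeMod k C (Fin 3))) (π : Finpartition S) :
    Op ε R π.parts →ₗ[k] MultilinearMap k (fun B : π.parts => Op ε R B.1) (Op ε R S) :=
  Op.lift
    { toFun := gammaAux ε R π
      map_add' := fun x y => by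
        ext q
        rw [add_apply, gammaAux_apply, gammaAux_apply, gammaAux_apply, ← map_add]
        congr 1
        exact Comp.ext (by simp [gammaComp])
      map_smul' := fun r x => by
        ext q
        rw [RingHom.id_apply, smul_apply, gammaAux_apply, gammaAux_apply, ← map_smul]
        congr 1
        exact Comp.ext (by simp [gammaComp]) }
    fun _ hx => MultilinearMap.ext fun _ => Op.mk_eq_zero.mpr (gammaComp_mem_left ε R π hx _)

/-- On classes of combinations of trees, operadic composition is given by grafting. -/
theorem gamma_mk (ε : C → ℤˣ) (R : Set (TreeMod k C (Fin 3))) (π : Finpartition S)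
    (x : Comp k C π.parts) (s : ∀ B : π.parts, Comp k C B.1) :
    gamma ε R π (Op.mk ε R π.parts x) (fun B => Op.mk ε R B.1 (s B))
      = Op.mk ε R S (gammaComp π x s) :=
  multilinearDescend_mk (fun B : π.parts => ideal ε R B.1)
    ((Op.mk ε R S).compMultilinearMap (gammaComp π x)) (mk_gammaComp_eq_zero ε R π x) s

end Composition

/-! ### The composite product and the map `ξ` -/

section Xi

variable {k : Type u} [Field k] {C₁ C₂ C : Type}

/-- The composite product `(P₂ ∘ P₁)[S] = ⨁_π P₂[π] ⊗ ⨂_{B ∈ π} P₁[B]`, the sum being over all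
partitions `π` of the finite set `S` into nonempty blocks `B`. Its elements are the formal
`μ(ν₁, …, ν_l)` with `μ ∈ P₂`, `ν_s ∈ P₁`, and `l` is the number of blocks. -/
abbrev Composite (ε₁ : C₁ → ℤˣ) (R₁ : Set (TreeMod k C₁ (Fin 3))) (ε₂ : C₂ → ℤˣ)
    (R₂ : Set (TreeMod k C₂ (Fin 3))) {X : Type} [DecidableEq X] (S : Finset X) : Type u :=
  ⨁ π : Finpartition S, Op ε₂ R₂ π.parts ⊗[k] (⨂[k] B : π.parts, Op ε₁ R₁ B.1)

/-- The map `ξ : (P₂ ∘ P₁)[S] → P[S]` that is induced by operad morphisms `P₁ → P`, `P₂ → P` (given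
by maps of generators) and by the composition of `P`. -/
noncomputable def xi {ε₁ : C₁ → ℤˣ} {R₁ : Set (TreeMod k C₁ (Fin 3))} {ε₂ : C₂ → ℤˣ}
    {R₂ : Set (TreeMod k C₂ (Fin 3))} {ε : C → ℤˣ} {R : Set (TreeMod k C (Fin 3))}
    (f₁ : C₁ → C) (f₂ : C₂ → C) (hε₁ : ∀ c, ε (f₁ c) = ε₁ c) (hε₂ : ∀ c, ε (f₂ c) = ε₂ c)
    (hR₁ : ∀ r ∈ R₁, recolorLin f₁ r ∈ R) (hR₂ : ∀ r ∈ R₂, recolorLin f₂ r ∈ R)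
    {X : Type} [DecidableEq X] (S : Finset X) :
    Composite ε₁ R₁ ε₂ R₂ S →ₗ[k] Op ε R S := by
  classical
  exact DirectSum.toModule k _ _ fun π =>
    TensorProduct.lift
      ((PiTensorProduct.lift (R := k) (s := fun B : π.parts => Op ε₁ R₁ B.1)).toLinearMap ∘ₗ
        MultilinearMap.compLinearMapₗ (fun B : π.parts => recolorOp f₁ hε₁ hR₁ B.1) ∘ₗ
        gamma ε R π ∘ₗ recolorOp f₂ hε₂ hR₂ π.parts)

end Xi

/-! ### Quadratic operads and distributive laws -/

section Quadratic

variable {C C₁ C₂ : Type}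

/-- `F(E)(3)`, the arity three component of the free operad on the `Σ₂`-module `E` with basis `C`
on which the transposition acts by `c ↦ ε(c) c`. -/
abbrev Free3 (k : Type u) [Field k] (ε : C → ℤˣ) : Type u :=
  Op (k := k) ε ∅ (Finset.univ : Finset (Fin 3))

/-- The combinations of trees that represent elements of `R ⊆ F(E)(3)`. -/
def relSet {k : Type u} [Field k] {ε : C → ℤˣ} (R : Submodule k (Free3 k ε)) :
    Set (TreeMod k C (Fin 3)) :=
  {x | ∃ hx : x ∈ Homog k C (Finset.univ : Finset (Fin 3)).val,
    Op.mk ε ∅ Finset.univ (Comp.mk x hx) ∈ R}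

/-- The component at `S` of the quadratic operad `⟨E; R⟩ = F(E)/(R)`. (It is written as one quotient
of the free operad without symmetry, by the ideal that the symmetries and the representatives of the
elements of `R` generate, i.e. by the preimage of the ideal `(R)` of `F(E)`.) -/
abbrev QuadOp {k : Type u} [Field k] {ε : C → ℤˣ} (R : Submodule k (Free3 k ε)) {X : Type}
    (S : Finset X) : Type u :=
  Op ε (relSet R) S

/-- The map `F(E')(3) → F(E)(3)` induced by a map of generators. -/
noncomputable def recolor3 (k : Type u) [Field k] {C' : Type} (f : C' → C) {ε' : C' → ℤˣ}
    {ε : C → ℤˣ} (hε : ∀ c, ε (f c) = ε' c) : Free3 k ε' →ₗ[k] Free3 k ε :=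
  recolorOp f hε (fun _ h => h.elim) Finset.univ

theorem recolorLin_mem_relSet {k : Type u} [Field k] {C' : Type} (f : C' → C) {ε' : C' → ℤˣ}
    {ε : C → ℤˣ} (hε : ∀ c, ε (f c) = ε' c) {R' : Submodule k (Free3 k ε')}
    {R : Submodule k (Free3 k ε)} (h : R'.map (recolor3 k f hε) ≤ R) :
    ∀ r ∈ relSet R', recolorLin f r ∈ relSet R := by
  rintro r ⟨hr, hrR⟩
  exact ⟨recolorLin_mem f hr, h ⟨_, hrR, rfl⟩⟩

/-- The span in `F(E)(3)` of the compositions `μ(1, ν)` and `μ(ν, 1)`, with all labellings of the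
inputs, where `μ` and `ν` are generators with `p μ` and `q ν`. -/
noncomputable def mixed (k : Type u) [Field k] (ε : C → ℤˣ) (p q : C → Prop) : Submodule k (Free3 k ε) :=
  Submodule.span k {z | ∃ (t : BTree C (Fin 3)) (ht : t.leaves = Finset.univ.val),
    z = ofTree ε ∅ Finset.univ t ht ∧
    ∃ (μ ν : C) (a b c : Fin 3), p μ ∧ q ν ∧
      (t = .node μ (.leaf a) (.node ν (.leaf b) (.leaf c)) ∨
        t = .node μ (.node ν (.leaf a) (.leaf b)) (.leaf c))}

/-- `mixed` is invariant under `Σ₃`. -/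
theorem act_mem_mixed {k : Type u} [Field k] {ε : C → ℤˣ} {p q : C → Prop}
    (σ : Equiv.Perm (Fin 3)) {x : Free3 k ε} (hx : x ∈ mixed k ε p q) :
    act ε ∅ σ x ∈ mixed k ε p q := by
  induction hx using Submodule.span_induction with
  | zero => simp
  | add x y _ _ hx hy => simpa using add_mem hx hy
  | smul r x _ hx => simpa using Submodule.smul_mem _ r hx
  | mem x h =>
    obtain ⟨t, ht, rfl, μ, ν, a, b, c, hμ, hν, h⟩ := h
    obtain ⟨h', e⟩ := act_ofTree (k := k) ε ∅ σ t ht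
    rw [e]
    refine Submodule.subset_span ⟨_, h', rfl, μ, ν, σ a, σ b, σ c, hμ, hν, ?_⟩
    rcases h with rfl | rfl
    · exact Or.inl rfl
    · exact Or.inr rfl

/-- `F(E₁ ⊕ E₂)(3)₁₂`: the outer operation is in `E₁` and the inner one in `E₂`. -/
noncomputable abbrev F12 (k : Type u) [Field k] (ε₁ : C₁ → ℤˣ) (ε₂ : C₂ → ℤˣ) :
    Submodule k (Free3 k (Sum.elim ε₁ ε₂)) :=
  mixed k (Sum.elim ε₁ ε₂) (fun c => c.isLeft) (fun c => c.isRight)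

/-- `F(E₁ ⊕ E₂)(3)₂₁`: the outer operation is in `E₂` and the inner one in `E₁`. -/
noncomputable abbrev F21 (k : Type u) [Field k] (ε₁ : C₁ → ℤˣ) (ε₂ : C₂ → ℤˣ) :
    Submodule k (Free3 k (Sum.elim ε₁ ε₂)) :=
  mixed k (Sum.elim ε₁ ε₂) (fun c => c.isRight) (fun c => c.isLeft)

variable {k : Type u} [Field k] {ε₁ : C₁ → ℤˣ} {ε₂ : C₂ → ℤˣ}

/-- The submodule `R₁ ⊕ R_D ⊕ R₂` of `F(E₁ ⊕ E₂)(3)`, where `R_D` consists of the `x - D x`. -/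
noncomputable def combinedRel (R₁ : Submodule k (Free3 k ε₁)) (R₂ : Submodule k (Free3 k ε₂))
    (D : F12 k ε₁ ε₂ →ₗ[k] F21 k ε₁ ε₂) : Submodule k (Free3 k (Sum.elim ε₁ ε₂)) :=
  R₁.map (recolor3 k (Sum.inl : C₁ → C₁ ⊕ C₂) fun _ => rfl) ⊔
    LinearMap.range ((F12 k ε₁ ε₂).subtype - (F21 k ε₁ ε₂).subtype ∘ₗ D) ⊔
    R₂.map (recolor3 k (Sum.inr : C₂ → C₁ ⊕ C₂) fun _ => rfl)

theorem inl_mem_combinedRel (R₁ : Submodule k (Free3 k ε₁)) (R₂ : Submodule k (Free3 k ε₂))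
    (D : F12 k ε₁ ε₂ →ₗ[k] F21 k ε₁ ε₂) :
    ∀ r ∈ relSet R₁, recolorLin (Sum.inl : C₁ → C₁ ⊕ C₂) r ∈ relSet (combinedRel R₁ R₂ D) :=
  recolorLin_mem_relSet (ε := Sum.elim ε₁ ε₂) (Sum.inl : C₁ → C₁ ⊕ C₂) (fun _ => rfl)
    (R' := R₁) (R := combinedRel R₁ R₂ D) (le_sup_left.trans le_sup_left)

theorem inr_mem_combinedRel (R₁ : Submodule k (Free3 k ε₁)) (R₂ : Submodule k (Free3 k ε₂))
    (D : F12 k ε₁ ε₂ →ₗ[k] F21 k ε₁ ε₂) :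
    ∀ r ∈ relSet R₂, recolorLin (Sum.inr : C₂ → C₁ ⊕ C₂) r ∈ relSet (combinedRel R₁ R₂ D) :=
  recolorLin_mem_relSet (ε := Sum.elim ε₁ ε₂) (Sum.inr : C₂ → C₁ ⊕ C₂) (fun _ => rfl)
    (R' := R₂) (R := combinedRel R₁ R₂ D) le_sup_right

/-- The map `ξ(n) : (P₂ ∘ P₁)(n) → P(n)`, where `P_i = ⟨E_i; R_i⟩` and
`P = ⟨E₁ ⊕ E₂; R₁ ⊕ R_D ⊕ R₂⟩`. -/
noncomputable def xiLaw (R₁ : Submodule k (Free3 k ε₁)) (R₂ : Submodule k (Free3 k ε₂))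
    (D : F12 k ε₁ ε₂ →ₗ[k] F21 k ε₁ ε₂) (n : ℕ) :
    Composite ε₁ (relSet R₁) ε₂ (relSet R₂) (Finset.univ : Finset (Fin n)) →ₗ[k]
      QuadOp (combinedRel R₁ R₂ D) (Finset.univ : Finset (Fin n)) :=
  xi (ε := Sum.elim ε₁ ε₂) (R := relSet (combinedRel R₁ R₂ D)) (Sum.inl : C₁ → C₁ ⊕ C₂)
    (Sum.inr : C₂ → C₁ ⊕ C₂) (fun _ => rfl) (fun _ => rfl) (inl_mem_combinedRel R₁ R₂ D)
    (inr_mem_combinedRel R₁ R₂ D) Finset.univ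

/-- `D : F(E₁ ⊕ E₂)(3)₁₂ → F(E₁ ⊕ E₂)(3)₂₁` is a distributive law of `P₁ = ⟨E₁; R₁⟩` over
`P₂ = ⟨E₂; R₂⟩`: it is `Σ₃`-equivariant and `ξ(n)` is an isomorphism for all `n ≥ 2`. -/
def IsDistributiveLaw (R₁ : Submodule k (Free3 k ε₁)) (R₂ : Submodule k (Free3 k ε₂))
    (D : F12 k ε₁ ε₂ →ₗ[k] F21 k ε₁ ε₂) : Prop :=
  (∀ (σ : Equiv.Perm (Fin 3)) (x : F12 k ε₁ ε₂),
    (D ⟨act _ ∅ σ x, act_mem_mixed σ x.2⟩ : Free3 k (Sum.elim ε₁ ε₂)) = act _ ∅ σ (D x)) ∧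
  ∀ n : ℕ, 2 ≤ n → Function.Bijective (xiLaw R₁ R₂ D n)

end Quadratic

/-! ### The operads `Com` and `Lie` -/

/-- The tree `(a b) c` in one binary operation. -/
abbrev leftComb (a b c : Fin 3) : BTree Unit (Fin 3) :=
  .node () (.node () (.leaf a) (.leaf b)) (.leaf c)

/-- The tree `a (b c)` in one binary operation. -/
abbrev rightComb (a b c : Fin 3) : BTree Unit (Fin 3) :=
  .node () (.leaf a) (.node () (.leaf b) (.leaf c))

theorem leaves_leftComb (σ : Equiv.Perm (Fin 3)) (i j l : Fin 3)
    (h : ({i} + {j} + {l} : Multiset (Fin 3)) = Finset.univ.val) :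
    (leftComb (σ i) (σ j) (σ l)).leaves = Finset.univ.val := by
  rw [← bind_perm σ, ← h]
  simp [BTree.leaves]

theorem leaves_rightComb (σ : Equiv.Perm (Fin 3)) (i j l : Fin 3)
    (h : ({i} + {j} + {l} : Multiset (Fin 3)) = Finset.univ.val) :
    (rightComb (σ i) (σ j) (σ l)).leaves = Finset.univ.val := by
  rw [← bind_perm σ, ← h]
  simp only [BTree.leaves, Multiset.add_bind, Multiset.singleton_bind, add_assoc]

/-- The generating operation of `Com` is symmetric. -/
abbrev comSign : Unit → ℤˣ := fun _ => 1

/-- The generating operation of `Lie` is antisymmetric. -/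
abbrev lieSign : Unit → ℤˣ := fun _ => -1

/-- The relations of `Com`: the `Σ₃`-module generated by associativity `(a b) c = a (b c)`. -/
noncomputable def comRel (k : Type u) [Field k] : Submodule k (Free3 k comSign) :=
  Submodule.span k (Set.range fun σ : Equiv.Perm (Fin 3) =>
    ofTree comSign ∅ Finset.univ (leftComb (σ 0) (σ 1) (σ 2)) (leaves_leftComb σ 0 1 2 rfl) -
    ofTree comSign ∅ Finset.univ (rightComb (σ 0) (σ 1) (σ 2)) (leaves_rightComb σ 0 1 2 rfl))

/-- The relations of `Lie`: the `Σ₃`-module generated by the Jacobi identity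
`[[a, b], c] + [[b, c], a] + [[c, a], b] = 0`. -/
noncomputable def lieRel (k : Type u) [Field k] : Submodule k (Free3 k lieSign) :=
  Submodule.span k (Set.range fun σ : Equiv.Perm (Fin 3) =>
    ofTree lieSign ∅ Finset.univ (leftComb (σ 0) (σ 1) (σ 2)) (leaves_leftComb σ 0 1 2 rfl) +
    ofTree lieSign ∅ Finset.univ (leftComb (σ 1) (σ 2) (σ 0))
      (leaves_leftComb σ 1 2 0 (by decide)) +
    ofTree lieSign ∅ Finset.univ (leftComb (σ 2) (σ 0) (σ 1))
      (leaves_leftComb σ 2 0 1 (by decide)))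

end DistLaw

/-!
A tree with operations of two kinds is normal if no operation of the second kind is inserted into
one of the first kind; the map `ξ` sends pure tensors of trees to normal trees.

If `D = 0`, then all trees that are not normal vanish in `P`, whence `ξ` is surjective. For its
injectivity, an algebra `W` over `P₁`, an algebra `F` over `P₂` and *any* linear map `φ : W → F`
make `W × F` an algebra over `P`. Applied to free algebras and to the map `φ` that picks out given
functionals on the blocks of a partition, this yields the coordinates of an element of `P₂ ∘ P₁`
from its image under `ξ`.

Conversely, a law of `Com` over `Com` or of `Lie` over `Lie` is given by three scalars:
`x · (y * z) = α x * (y · z) + β y * (z · x) + γ z * (x · y)`. Rewriting one element of `P(4)` in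
two ways produces a combination of normal trees that vanishes in `P`. As `ξ(4)` is injective, the
same combination vanishes in the operad of the trivial law, and so in the algebras `W × F`. For
`Com` one starts from `a · b · (c * d)`, for `Lie` from `(a * b) · (c * d)`; the algebras with
`W = k²`, `F = k`, resp. `W = F = k³` with the cross product, force `α = β = γ = 0`.
-/

namespace DistLaw

universe v w

/-! ### Algebras over a quadratic operad -/

section Algebras

variable {k : Type u} [Field k] {C C' X Y : Type}
variable {A : Type v} [AddCommGroup A] [Module k A] {B : Type w} [AddCommGroup B] [Module k B]

/-- The value of a tree in a space `A` with bilinear operations `op c`, the leaves being evaluated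
by `s`. -/
def treeVal (op : C → A →ₗ[k] A →ₗ[k] A) (s : X → A) : BTree C X → A
  | .leaf x => s x
  | .node c l r => op c (treeVal op s l) (treeVal op s r)

/-- The linear extension of `treeVal` to combinations of trees. -/
noncomputable def evalAlg (op : C → A →ₗ[k] A →ₗ[k] A) (s : X → A) : TreeMod k C X →ₗ[k] A :=
  Finsupp.linearCombination k (treeVal op s)

@[simp] theorem evalAlg_single (op : C → A →ₗ[k] A →ₗ[k] A) (s : X → A) (t : BTree C X) (a : k) :
    evalAlg op s (Finsupp.single t a) = a • treeVal op s t := by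
  simp [evalAlg]

/-- Homomorphisms of spaces with bilinear operations. -/
def IsOpHom (op : C → A →ₗ[k] A →ₗ[k] A) (op' : C → B →ₗ[k] B →ₗ[k] B) (f : A →ₗ[k] B) : Prop :=
  ∀ c x y, f (op c x y) = op' c (f x) (f y)

theorem IsOpHom.map_treeVal {op : C → A →ₗ[k] A →ₗ[k] A} {op' : C → B →ₗ[k] B →ₗ[k] B}
    {f : A →ₗ[k] B} (hf : IsOpHom op op' f) (s : X → A) (t : BTree C X) :
    f (treeVal op s t) = treeVal op' (fun x => f (s x)) t := by
  induction t with
  | leaf x => rfl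
  | node c l r hl hr => rw [treeVal, hf, hl, hr, treeVal]

theorem IsOpHom.map_evalAlg {op : C → A →ₗ[k] A →ₗ[k] A} {op' : C → B →ₗ[k] B →ₗ[k] B}
    {f : A →ₗ[k] B} (hf : IsOpHom op op' f) (s : X → A) (x : TreeMod k C X) :
    f (evalAlg op s x) = evalAlg op' (fun x => f (s x)) x := by
  have h : f ∘ₗ evalAlg op s = evalAlg op' (fun x => f (s x)) := by
    ext t
    simp [hf.map_treeVal]
  exact congr($h x)

theorem isOpHom_evalAlg (op : C → A →ₗ[k] A →ₗ[k] A) (s : X → A) :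
    IsOpHom graft op (evalAlg op s) := fun c x y => by
  have h : (graft c).compr₂ (evalAlg op s) = (op c).compl₁₂ (evalAlg op s) (evalAlg op s) := by
    ext l r
    simp [treeVal]
  exact congr($h x y)

theorem subst_eq_evalAlg (u : Y → TreeMod k C X) : subst u = evalAlg graft u := by
  have h : evalTree u = treeVal graft u := by
    funext t
    induction t with
    | leaf y => rfl
    | node c l r hl hr => rw [evalTree, hl, hr, treeVal]
  rw [subst, h, evalAlg]

theorem IsOpHom.map_subst {op : C → A →ₗ[k] A →ₗ[k] A} {f : TreeMod k C X →ₗ[k] A}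
    (hf : IsOpHom graft op f) (u : Y → TreeMod k C X) (x : TreeMod k C Y) :
    f (subst u x) = evalAlg op (fun y => f (u y)) x := by
  rw [subst_eq_evalAlg, hf.map_evalAlg]

theorem evalAlg_recolorLin (op : C' → A →ₗ[k] A →ₗ[k] A) (s : X → A) (f : C → C')
    (x : TreeMod k C X) :
    evalAlg op s (recolorLin f x) = evalAlg (fun c => op (f c)) s x := by
  have htree (t : BTree C X) : treeVal op s (t.recolor f) = treeVal (fun c => op (f c)) s t := by
    induction t with
    | leaf y => rfl
    | node c l r hl hr => rw [BTree.recolor, treeVal, hl, hr, treeVal]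
  have h : evalAlg op s ∘ₗ recolorLin f = evalAlg (fun c => op (f c)) s := by
    ext t
    simp [htree]
  exact congr($h x)

/-- `A`, with the operations `op`, is an algebra over the operad with generators `C` of symmetry `ε`
and relations `R`. -/
structure IsOperadAlgebra (ε : C → ℤˣ) (R : Set (TreeMod k C (Fin 3)))
    (op : C → A →ₗ[k] A →ₗ[k] A) : Prop where
  symm : ∀ c x y, op c x y = ((ε c : ℤ) : k) • op c y x
  rel : ∀ r ∈ R, ∀ s : Fin 3 → A, evalAlg op s r = 0

variable {ε : C → ℤˣ} {R : Set (TreeMod k C (Fin 3))} {op : C → A →ₗ[k] A →ₗ[k] A}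

theorem IsOperadAlgebra.evalAlg_eq_zero (h : IsOperadAlgebra ε R op) (s : X → A)
    {m : Multiset X} {x : TreeMod k C X} (hx : IdealMem ε R m x) : evalAlg op s x = 0 := by
  have hom := isOpHom_evalAlg op s
  induction hx with
  | symm c x y => rw [map_sub, map_smul, hom, hom, h.symm c, sub_self]
  | rel hr d u => rw [hom.map_subst, h.rel _ hr]
  | graft_left c _ y ih => rw [hom, ih, map_zero, LinearMap.zero_apply]
  | graft_right c x _ ih => rw [hom, ih, map_zero]
  | zero => rw [map_zero]
  | add _ _ hx hy => rw [map_add, hx, hy, add_zero]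
  | smul r _ hx => rw [map_smul, hx, smul_zero]

/-- The value of an operation in an algebra over the operad. -/
noncomputable def IsOperadAlgebra.evalOp (h : IsOperadAlgebra ε R op) (S : Finset X) (s : X → A) :
    Op ε R S →ₗ[k] A :=
  Op.lift (evalAlg op s ∘ₗ Comp.val) fun _ hx => h.evalAlg_eq_zero s hx

theorem IsOperadAlgebra.evalOp_mk (h : IsOperadAlgebra ε R op) (S : Finset X) (s : X → A)
    (x : Comp k C S) : h.evalOp S s (Op.mk ε R S x) = evalAlg op s x.val := rfl

theorem IsOperadAlgebra.evalOp_ofTree (h : IsOperadAlgebra ε R op) (S : Finset X) (s : X → A)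
    (t : BTree C X) (ht : t.leaves = S.val) :
    h.evalOp S s (ofTree ε R S t ht) = treeVal op s t := by
  rw [ofTree, h.evalOp_mk, Comp.val_mk, evalAlg_single, one_smul]

theorem isOperadAlgebra_empty (hε : ∀ c x y, op c x y = ((ε c : ℤ) : k) • op c y x) :
    IsOperadAlgebra ε ∅ op :=
  ⟨hε, fun _ hr => hr.elim⟩

theorem isOperadAlgebra_relSet_iff (h : IsOperadAlgebra ε ∅ op) {R : Submodule k (Free3 k ε)} :
    IsOperadAlgebra ε (relSet R) op ↔
      ∀ s : Fin 3 → A, R ≤ LinearMap.ker (h.evalOp Finset.univ s) := by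
  refine ⟨fun hR s r hr => ?_, fun hR => ⟨h.symm, fun r hr s => hR s hr.2⟩⟩
  obtain ⟨x, rfl⟩ := Op.mk_surjective _ _ _ r
  exact hR.rel x.val ⟨x.val_mem, hr⟩ s

end Algebras

section CombinedAlgebras

variable {k : Type u} [Field k] {C₁ C₂ : Type} {ε₁ : C₁ → ℤˣ} {ε₂ : C₂ → ℤˣ}
variable {A : Type v} [AddCommGroup A] [Module k A]

theorem map_recolor3_le_ker_evalOp_iff {C C' : Type} {f : C' → C} {ε' : C' → ℤˣ} {ε : C → ℤˣ}
    (hε : ∀ c, ε (f c) = ε' c) {op : C → A →ₗ[k] A →ₗ[k] A} (h : IsOperadAlgebra ε ∅ op)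
    (h' : IsOperadAlgebra ε' ∅ fun c => op (f c)) {R : Submodule k (Free3 k ε')} (s : Fin 3 → A) :
    R.map (recolor3 k f hε) ≤ LinearMap.ker (h.evalOp Finset.univ s) ↔
      R ≤ LinearMap.ker (h'.evalOp Finset.univ s) := by
  have hcomp : h.evalOp Finset.univ s ∘ₗ recolor3 k f hε = h'.evalOp Finset.univ s := by
    ext x
    obtain ⟨x, rfl⟩ := Op.mk_surjective _ _ _ x
    exact evalAlg_recolorLin op s f x.val
  rw [Submodule.map_le_iff_le_comap, ← LinearMap.ker_comp, hcomp]

theorem isOperadAlgebra_combinedRel_iff {op : C₁ ⊕ C₂ → A →ₗ[k] A →ₗ[k] A}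
    (h : IsOperadAlgebra (Sum.elim ε₁ ε₂) ∅ op) {R₁ : Submodule k (Free3 k ε₁)}
    {R₂ : Submodule k (Free3 k ε₂)} {D : F12 k ε₁ ε₂ →ₗ[k] F21 k ε₁ ε₂} :
    IsOperadAlgebra (Sum.elim ε₁ ε₂) (relSet (combinedRel R₁ R₂ D)) op ↔
      IsOperadAlgebra ε₁ (relSet R₁) (fun c => op (.inl c)) ∧
      IsOperadAlgebra ε₂ (relSet R₂) (fun c => op (.inr c)) ∧
      ∀ (s : Fin 3 → A) (x : F12 k ε₁ ε₂),
        h.evalOp Finset.univ s x = h.evalOp Finset.univ s (D x) := by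
  have h₁ : IsOperadAlgebra ε₁ ∅ fun c => op (.inl c) :=
    isOperadAlgebra_empty fun c => h.symm (.inl c)
  have h₂ : IsOperadAlgebra ε₂ ∅ fun c => op (.inr c) :=
    isOperadAlgebra_empty fun c => h.symm (.inr c)
  have hlaw (s : Fin 3 → A) :
      LinearMap.range ((F12 k ε₁ ε₂).subtype - (F21 k ε₁ ε₂).subtype ∘ₗ D) ≤
          LinearMap.ker (h.evalOp Finset.univ s) ↔
        ∀ x : F12 k ε₁ ε₂, h.evalOp Finset.univ s x = h.evalOp Finset.univ s (D x) := by
    simp [LinearMap.range_le_ker_iff, LinearMap.ext_iff, sub_eq_zero]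
  have hR₁ := map_recolor3_le_ker_evalOp_iff (f := Sum.inl) (fun _ => rfl) h h₁ (R := R₁)
  have hR₂ := map_recolor3_le_ker_evalOp_iff (f := Sum.inr) (fun _ => rfl) h h₂ (R := R₂)
  simp only [isOperadAlgebra_relSet_iff h, isOperadAlgebra_relSet_iff h₁,
    isOperadAlgebra_relSet_iff h₂, combinedRel, sup_le_iff, hR₁, hR₂, hlaw, forall_and]
  tauto

end CombinedAlgebras

/-! ### Free algebras -/

section FreeAlgebra

variable {k : Type u} [Field k] {C X : Type} (ε : C → ℤˣ) (R : Set (TreeMod k C (Fin 3)))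

/-- The sum of all components of the ideal of relations, including those at multisets with repeated
leaves. -/
noncomputable def totalIdeal (X : Type) : Submodule k (TreeMod k C X) :=
  Submodule.span k {x | ∃ m, IdealMem ε R m x}

/-- The free algebra on the set `X` over the operad with generators `C` of symmetry `ε` and
relations `R`. -/
abbrev FreeAlg (X : Type) : Type u :=
  TreeMod k C X ⧸ totalIdeal ε R X

variable {ε R}

theorem IdealMem.mkQ_eq_zero {m : Multiset X} {x : TreeMod k C X} (h : IdealMem ε R m x) :
    (totalIdeal ε R X).mkQ x = 0 :=
  (Submodule.Quotient.mk_eq_zero _).mpr (Submodule.subset_span ⟨m, h⟩)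

theorem map₂_graft_totalIdeal_top_le (c : C) :
    Submodule.map₂ (graft c) (totalIdeal ε R X) ⊤ ≤ totalIdeal ε R X := by
  rw [← Finsupp.basisSingleOne.span_eq, totalIdeal, Submodule.map₂_span_span, Submodule.span_le,
    Set.image2_subset_iff]
  rintro x ⟨m, hx⟩ _ ⟨t, rfl⟩
  exact Submodule.subset_span ⟨_, .graft_left c hx ⟨_, single_mem_Homog rfl 1⟩⟩

theorem map₂_graft_top_totalIdeal_le (c : C) :
    Submodule.map₂ (graft c) ⊤ (totalIdeal ε R X) ≤ totalIdeal ε R X := by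
  rw [← Finsupp.basisSingleOne.span_eq, totalIdeal, Submodule.map₂_span_span, Submodule.span_le,
    Set.image2_subset_iff]
  rintro _ ⟨t, rfl⟩ y ⟨m, hy⟩
  exact Submodule.subset_span ⟨_, .graft_right c ⟨_, single_mem_Homog rfl 1⟩ hy⟩

variable (ε R)

/-- The operations of the free algebra. -/
noncomputable def freeOp (X : Type) (c : C) :
    FreeAlg ε R X →ₗ[k] FreeAlg ε R X →ₗ[k] FreeAlg ε R X :=
  ((graft c).compr₂ (totalIdeal ε R X).mkQ).liftQ₂ (totalIdeal ε R X) (totalIdeal ε R X)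
    (fun _ hx => LinearMap.ext fun _ => (Submodule.Quotient.mk_eq_zero _).mpr <|
      map₂_graft_totalIdeal_top_le c <| Submodule.apply_mem_map₂ _ hx trivial)
    (fun _ hy => LinearMap.ext fun _ => (Submodule.Quotient.mk_eq_zero _).mpr <|
      map₂_graft_top_totalIdeal_le c <| Submodule.apply_mem_map₂ _ trivial hy)

theorem isOpHom_mkQ : IsOpHom graft (freeOp ε R X) (totalIdeal ε R X).mkQ := fun _ _ _ => rfl

variable {ε R}

/-- For `x` in the multilinear part of the tree module, `s ↦ subst s x` as a multilinear map. -/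
noncomputable def substMultilinear {Y : Type} [Fintype Y] {x : TreeMod k C Y}
    (hx : x ∈ Homog k C (Finset.univ : Finset Y).val) :
    MultilinearMap k (fun _ : Y => TreeMod k C X) (TreeMod k C X) where
  toFun s := subst s x
  map_update_add' s y a b := by
    simpa using subst_lin (s := Function.update s y (a + b)) (s₁ := Function.update s y a)
      (s₂ := Function.update s y b) (Finset.nodup _) (Finset.mem_univ y) 1 1
      (fun z hz => by simp [hz]) (fun z hz => by simp [hz]) (by simp) hx
  map_update_smul' s y r a := by
    simpa using subst_lin (s := Function.update s y (r • a)) (s₁ := Function.update s y a)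
      (s₂ := Function.update s y a) (Finset.nodup _) (Finset.mem_univ y) r 0
      (fun z hz => by simp [hz]) (fun z hz => by simp [hz]) (by simp) hx

theorem mkQ_subst_eq_zero {r : TreeMod k C (Fin 3)} (hr : r ∈ R)
    (hr' : r ∈ Homog k C (Finset.univ : Finset (Fin 3)).val) (u : Fin 3 → TreeMod k C X) :
    (totalIdeal ε R X).mkQ (subst u r) = 0 := by
  have h : (totalIdeal ε R X).mkQ.compMultilinearMap (substMultilinear hr') = 0 :=
    Module.Basis.ext_multilinear (fun _ => Finsupp.basisSingleOne) fun t =>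
      (IdealMem.rel hr (fun i => (t i).leaves)
        fun i => ⟨_, single_mem_Homog rfl 1⟩).mkQ_eq_zero
  exact congr($h u)

theorem isOperadAlgebra_freeOp (hR : ∀ r ∈ R, r ∈ Homog k C (Finset.univ : Finset (Fin 3)).val)
    (X : Type) : IsOperadAlgebra ε R (freeOp ε R X) where
  symm c x y := by
    have h : freeOp ε R X c = ((ε c : ℤ) : k) • (freeOp ε R X c).flip := by
      ext l r
      exact sub_eq_zero.mp (IdealMem.symm (ε := ε) (R := R) c
        ⟨_, single_mem_Homog (m := l.leaves) rfl 1⟩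
        ⟨_, single_mem_Homog (m := r.leaves) rfl 1⟩).mkQ_eq_zero
    exact congr($h x y)
  rel r hr s := by
    choose u hu using fun i => Submodule.mkQ_surjective (totalIdeal ε R X) (s i)
    obtain rfl : (fun i => (totalIdeal ε R X).mkQ (u i)) = s := funext hu
    rw [← (isOpHom_mkQ ε R).map_subst, mkQ_subst_eq_zero hr (hR r hr)]

theorem IdealMem.mem_Homog (hR : ∀ r ∈ R, r ∈ Homog k C (Finset.univ : Finset (Fin 3)).val)
    {m : Multiset X} {x : TreeMod k C X} (hx : IdealMem ε R m x) : x ∈ Homog k C m := by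
  induction hx with
  | symm c x y =>
    refine sub_mem (graft_mem x.2 y.2) (Submodule.smul_mem _ _ ?_)
    simpa only [add_comm] using graft_mem y.2 x.2
  | rel hr d u =>
    have h_univ : (Finset.univ : Finset (Fin 3)).val = {0} + {1} + {2} := rfl
    simpa only [h_univ, Multiset.add_bind, Multiset.singleton_bind] using
      subst_mem (fun i => (u i).2) (hR _ hr)
  | graft_left c _ y ih => exact graft_mem ih y.2
  | graft_right c x _ ih => exact graft_mem x.2 ih
  | zero => exact zero_mem _
  | add _ _ h h' => exact add_mem h h'
  | smul r _ h => exact Submodule.smul_mem _ r h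

open Classical in
/-- The projection of the tree module onto its component at `S`. -/
noncomputable def compProj (S : Finset X) : TreeMod k C X →ₗ[k] Comp k C S :=
  Finsupp.restrictDom k k {t : BTree C X | t.leaves = S.val}

theorem compProj_val {S : Finset X} (x : Comp k C S) : compProj S x.val = x := by
  classical exact LinearMap.congr_fun (Finsupp.restrictDom_comp_subtype _) x

theorem compProj_of_ne {S : Finset X} {m : Multiset X} (hm : m ≠ S.val) {x : TreeMod k C X}
    (hx : x ∈ Homog k C m) : compProj S x = 0 := by
  classical
  refine Comp.ext ((Finsupp.filter_eq_zero_iff _ _).mpr fun t ht => ?_)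
  by_contra h
  exact hm ((hx (Finsupp.mem_support_iff.mpr h)).symm.trans ht)

/-- The projection of the free algebra onto its multilinear part at `S`. -/
noncomputable def FreeAlg.toOp (hR : ∀ r ∈ R, r ∈ Homog k C (Finset.univ : Finset (Fin 3)).val)
    (S : Finset X) : FreeAlg ε R X →ₗ[k] Op ε R S :=
  (totalIdeal ε R X).liftQ (Op.mk ε R S ∘ₗ compProj S) <| by
    refine Submodule.span_le.mpr ?_
    rintro x ⟨m, hx⟩
    rw [SetLike.mem_coe, LinearMap.mem_ker, LinearMap.comp_apply]
    by_cases hm : m = S.val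
    · subst hm
      rw [← Comp.val_mk x (hx.mem_Homog hR), compProj_val]
      exact Op.mk_eq_zero.mpr hx
    · rw [compProj_of_ne hm (hx.mem_Homog hR), map_zero]

theorem FreeAlg.toOp_mkQ_val (hR : ∀ r ∈ R, r ∈ Homog k C (Finset.univ : Finset (Fin 3)).val)
    {S : Finset X} (x : Comp k C S) :
    FreeAlg.toOp hR S ((totalIdeal ε R X).mkQ x.val) = Op.mk ε R S x :=
  congrArg (Op.mk ε R S) (compProj_val x)

theorem FreeAlg.toOp_mkQ_of_ne (hR : ∀ r ∈ R, r ∈ Homog k C (Finset.univ : Finset (Fin 3)).val)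
    {S : Finset X} {m : Multiset X} (hm : m ≠ S.val) {x : TreeMod k C X}
    (hx : x ∈ Homog k C m) : FreeAlg.toOp hR S ((totalIdeal ε R X).mkQ x) = 0 :=
  (congrArg (Op.mk ε R S) (compProj_of_ne hm hx)).trans (map_zero _)

theorem evalAlg_graft_leaf (x : TreeMod k C X) :
    evalAlg graft (fun i => Finsupp.single (.leaf i) 1) x = x := by
  have htree (t : BTree C X) :
      treeVal graft (fun i => Finsupp.single (.leaf i) (1 : k)) t = Finsupp.single t 1 := by
    induction t with
    | leaf i => rfl
    | node c l r hl hr => rw [treeVal, hl, hr, graft_single, one_mul]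
  have h : evalAlg graft (fun i => Finsupp.single (.leaf i) 1) =
      (LinearMap.id : TreeMod k C X →ₗ[k] _) := by
    ext t
    simp [htree]
  exact congr($h x)

variable (ε R) in
/-- The generators of the free algebra. -/
noncomputable def FreeAlg.gen (i : X) : FreeAlg ε R X :=
  (totalIdeal ε R X).mkQ (Finsupp.single (.leaf i) 1)

theorem evalAlg_freeOp_gen (x : TreeMod k C X) :
    evalAlg (freeOp ε R X) (FreeAlg.gen ε R) x = (totalIdeal ε R X).mkQ x :=
  ((isOpHom_mkQ ε R).map_evalAlg _ x).symm.trans (congrArg _ (evalAlg_graft_leaf x))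

theorem ofTree_eq_toOp_treeVal (hR : ∀ r ∈ R, r ∈ Homog k C (Finset.univ : Finset (Fin 3)).val)
    {S : Finset X} {t : BTree C X} (ht : t.leaves = S.val) :
    ofTree ε R S t ht = FreeAlg.toOp hR S (treeVal (freeOp ε R X) (FreeAlg.gen ε R) t) := by
  rw [← one_smul k (treeVal _ _ t), ← evalAlg_single, evalAlg_freeOp_gen]
  exact (FreeAlg.toOp_mkQ_val hR _).symm

theorem mem_Homog_of_mem_relSet {R : Submodule k (Free3 k ε)} :
    ∀ r ∈ relSet R, r ∈ Homog k C (Finset.univ : Finset (Fin 3)).val := fun _ h => h.1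

end FreeAlgebra

/-! ### Algebras over the operad of the trivial law -/

section MixedAlgebra

variable {k : Type u} [Field k] {C₁ C₂ : Type}
variable {W : Type v} [AddCommGroup W] [Module k W] {F : Type w} [AddCommGroup F] [Module k F]

/-- The operations on `W × F` for which the first kind of operation is that of `W`, followed by the
graph of `φ`, and the second kind of operation is that of `F`, followed by the inclusion of `F`. A
composition of the first kind with the second one vanishes, because the inclusion of `F` is followed
by the projection to `W`. -/
noncomputable def mixOp (op₁ : C₁ → W →ₗ[k] W →ₗ[k] W) (op₂ : C₂ → F →ₗ[k] F →ₗ[k] F)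
    (φ : W →ₗ[k] F) : C₁ ⊕ C₂ → (W × F) →ₗ[k] (W × F) →ₗ[k] (W × F) :=
  Sum.elim
    (fun c => ((op₁ c).compl₁₂ (LinearMap.fst k W F) (LinearMap.fst k W F)).compr₂
      (LinearMap.prod LinearMap.id φ))
    (fun c => ((op₂ c).compl₁₂ (LinearMap.snd k W F) (LinearMap.snd k W F)).compr₂
      (LinearMap.inr k W F))

variable (op₁ : C₁ → W →ₗ[k] W →ₗ[k] W) (op₂ : C₂ → F →ₗ[k] F →ₗ[k] F) (φ : W →ₗ[k] F)

@[simp] theorem mixOp_inl_apply (c : C₁) (x y : W × F) :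
    mixOp op₁ op₂ φ (.inl c) x y = (op₁ c x.1 y.1, φ (op₁ c x.1 y.1)) := rfl

@[simp] theorem mixOp_inr_apply (c : C₂) (x y : W × F) :
    mixOp op₁ op₂ φ (.inr c) x y = (0, op₂ c x.2 y.2) := rfl

theorem isOpHom_fst_mixOp_inl :
    IsOpHom (fun c => mixOp op₁ op₂ φ (.inl c)) op₁ (LinearMap.fst k W F) := fun _ _ _ => rfl

theorem isOpHom_graph_mixOp_inl :
    IsOpHom op₁ (fun c => mixOp op₁ op₂ φ (.inl c)) (LinearMap.prod LinearMap.id φ) :=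
  fun _ _ _ => rfl

theorem isOpHom_snd_mixOp_inr :
    IsOpHom (fun c => mixOp op₁ op₂ φ (.inr c)) op₂ (LinearMap.snd k W F) := fun _ _ _ => rfl

theorem evalAlg_mem_of_card_ne_one {C X : Type} {op : C → W →ₗ[k] W →ₗ[k] W} {p : Submodule k W}
    (hp : ∀ c x y, op c x y ∈ p) (s : X → W) {m : Multiset X} (hm : m.card ≠ 1)
    {x : TreeMod k C X} (hx : x ∈ Homog k C m) : evalAlg op s x ∈ p := by
  refine Homog_induction (p := fun x => evalAlg op s x ∈ p) ?_ (by simp)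
    (fun x y hx hy => by simpa using add_mem hx hy)
    (fun a x hx => by simpa using Submodule.smul_mem _ a hx) hx
  rintro (y | ⟨c, l, r⟩) rfl
  · exact absurd (Multiset.card_singleton y) hm
  · simpa [treeVal] using hp _ _ _

variable {op₁ op₂} {ε₁ : C₁ → ℤˣ} {ε₂ : C₂ → ℤˣ} {R₁ : Submodule k (Free3 k ε₁)}
  {R₂ : Submodule k (Free3 k ε₂)}

theorem isOperadAlgebra_mixOp_inl (h₁ : IsOperadAlgebra ε₁ (relSet R₁) op₁) :
    IsOperadAlgebra ε₁ (relSet R₁) fun c => mixOp op₁ op₂ φ (.inl c) where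
  symm c x y := by simp [h₁.symm c x.1 y.1]
  rel r hr s := by
    have h_fst : (evalAlg (fun c => mixOp op₁ op₂ φ (.inl c)) s r).1 = 0 :=
      ((isOpHom_fst_mixOp_inl op₁ op₂ φ).map_evalAlg s r).trans (h₁.rel r hr _)
    have h_graph : evalAlg (fun c => mixOp op₁ op₂ φ (.inl c)) s r ∈ φ.graph :=
      evalAlg_mem_of_card_ne_one (fun _ _ _ => rfl) s (by decide) (mem_Homog_of_mem_relSet r hr)
    rw [LinearMap.mem_graph_iff, h_fst, map_zero] at h_graph
    exact Prod.ext h_fst h_graph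

theorem isOperadAlgebra_mixOp_inr (h₂ : IsOperadAlgebra ε₂ (relSet R₂) op₂) :
    IsOperadAlgebra ε₂ (relSet R₂) fun c => mixOp op₁ op₂ φ (.inr c) where
  symm c x y := by simp [h₂.symm c x.2 y.2]
  rel r hr s := by
    have h_fst : evalAlg (fun c => mixOp op₁ op₂ φ (.inr c)) s r ∈
        LinearMap.ker (LinearMap.fst k W F) :=
      evalAlg_mem_of_card_ne_one (fun _ _ _ => rfl) s (by decide) (mem_Homog_of_mem_relSet r hr)
    exact Prod.ext h_fst <|
      ((isOpHom_snd_mixOp_inr op₁ op₂ φ).map_evalAlg s r).trans (h₂.rel r hr _)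

theorem isOperadAlgebra_mixOp (h₁ : IsOperadAlgebra ε₁ (relSet R₁) op₁)
    (h₂ : IsOperadAlgebra ε₂ (relSet R₂) op₂) :
    IsOperadAlgebra (Sum.elim ε₁ ε₂) (relSet (combinedRel R₁ R₂ 0)) (mixOp op₁ op₂ φ) := by
  have hinl := isOperadAlgebra_mixOp_inl (op₂ := op₂) φ h₁
  have hinr := isOperadAlgebra_mixOp_inr (op₁ := op₁) φ h₂
  have hsymm : IsOperadAlgebra (Sum.elim ε₁ ε₂) ∅ (mixOp op₁ op₂ φ) :=
    isOperadAlgebra_empty (Sum.rec hinl.symm hinr.symm)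
  refine (isOperadAlgebra_combinedRel_iff hsymm).mpr ⟨hinl, hinr, fun s x => ?_⟩
  suffices hF12 : F12 k ε₁ ε₂ ≤ LinearMap.ker (hsymm.evalOp Finset.univ s) by
    simpa using hF12 x.2
  refine Submodule.span_le.mpr ?_
  rintro _ ⟨t, ht, rfl, μ, ν, a, b, c, hμ, hν, h⟩
  obtain ⟨μ, rfl⟩ := Sum.isLeft_iff.mp hμ
  obtain ⟨ν, rfl⟩ := Sum.isRight_iff.mp hν
  rw [SetLike.mem_coe, LinearMap.mem_ker, hsymm.evalOp_ofTree]
  rcases h with rfl | rfl <;> simp [treeVal]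

end MixedAlgebra

/-! ### Values of `ξ` -/

section XiValues

variable {k : Type u} [Field k] {C₁ C₂ C X : Type}

/-- The map on components that renames the operations along `f`. -/
noncomputable def Comp.recolor (f : C₁ → C) (S : Finset X) : Comp k C₁ S →ₗ[k] Comp k C S :=
  Comp.restrict (recolorLin f) fun _ hx => recolorLin_mem f hx

variable [DecidableEq X] {S : Finset X} {ε₁ : C₁ → ℤˣ} {R₁ : Set (TreeMod k C₁ (Fin 3))}
  {ε₂ : C₂ → ℤˣ} {R₂ : Set (TreeMod k C₂ (Fin 3))}

open Classical in
/-- The element `x ⊗ ⨂ B, s B` of the summand `π` of the composite product. -/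
noncomputable def pureComposite (π : Finpartition S) (x : Op ε₂ R₂ π.parts)
    (s : ∀ B : π.parts, Op ε₁ R₁ B.1) : Composite ε₁ R₁ ε₂ R₂ S :=
  DirectSum.lof k (Finpartition S)
    (fun π => Op ε₂ R₂ π.parts ⊗[k] (⨂[k] B : π.parts, Op ε₁ R₁ B.1)) π
    (x ⊗ₜ PiTensorProduct.tprod k s)

theorem xi_pureComposite {ε : C → ℤˣ} {R : Set (TreeMod k C (Fin 3))} (f₁ : C₁ → C) (f₂ : C₂ → C)
    (hε₁ : ∀ c, ε (f₁ c) = ε₁ c) (hε₂ : ∀ c, ε (f₂ c) = ε₂ c)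
    (hR₁ : ∀ r ∈ R₁, recolorLin f₁ r ∈ R) (hR₂ : ∀ r ∈ R₂, recolorLin f₂ r ∈ R)
    (π : Finpartition S) (x : Comp k C₂ π.parts) (s : ∀ B : π.parts, Comp k C₁ B.1) :
    xi (ε := ε) (R := R) f₁ f₂ hε₁ hε₂ hR₁ hR₂ S
        (pureComposite π (Op.mk ε₂ R₂ π.parts x) fun B => Op.mk ε₁ R₁ B.1 (s B)) =
      Op.mk ε R S
        (gammaComp π (Comp.recolor f₂ π.parts x) fun B => Comp.recolor f₁ B.1 (s B)) := by
  refine (DirectSum.toModule_lof k π _).trans ?_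
  rw [TensorProduct.lift.tmul]
  simp only [LinearMap.comp_apply, LinearEquiv.coe_coe, PiTensorProduct.lift.tprod]
  exact gamma_mk ε R π (Comp.recolor f₂ π.parts x) fun B => Comp.recolor f₁ B.1 (s B)

end XiValues

/-! ### Normal trees -/

section NormalTrees

variable {k : Type u} [Field k] {C C₁ C₂ X : Type}

/-- A tree all of whose operations are of the first kind. -/
def BTree.IsPure : BTree (C₁ ⊕ C₂) X → Prop
  | leaf _ => True
  | node c l r => c.isLeft ∧ l.IsPure ∧ r.IsPure

/-- A tree in which no operation of the second kind is inserted into one of the first kind. -/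
def BTree.IsNormal : BTree (C₁ ⊕ C₂) X → Prop
  | leaf _ => True
  | node (.inl _) l r => l.IsPure ∧ r.IsPure
  | node (.inr _) l r => l.IsNormal ∧ r.IsNormal

/-- The tree obtained from a tree of trees by grafting the inner trees, of the first kind, onto the
leaves of the outer tree, of the second kind. -/
def BTree.flatten : BTree C₂ (BTree C₁ X) → BTree (C₁ ⊕ C₂) X
  | leaf t => t.recolor .inl
  | node c l r => node (.inr c) l.flatten r.flatten

theorem BTree.IsPure.exists_recolor {t : BTree (C₁ ⊕ C₂) X} (h : t.IsPure) :
    ∃ t₁ : BTree C₁ X, t₁.recolor .inl = t := by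
  induction t with
  | leaf x => exact ⟨.leaf x, rfl⟩
  | node c l r hl hr =>
    obtain ⟨hc, hpl, hpr⟩ := h
    obtain ⟨c, rfl⟩ := Sum.isLeft_iff.mp hc
    obtain ⟨l, rfl⟩ := hl hpl
    obtain ⟨r, rfl⟩ := hr hpr
    exact ⟨.node c l r, rfl⟩

theorem BTree.IsNormal.exists_flatten {t : BTree (C₁ ⊕ C₂) X} (h : t.IsNormal) :
    ∃ T : BTree C₂ (BTree C₁ X), T.flatten = t := by
  induction t with
  | leaf x => exact ⟨.leaf (.leaf x), rfl⟩
  | node c l r hl hr =>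
    rcases c with c | c
    · obtain ⟨t, ht⟩ := IsPure.exists_recolor (t := .node (.inl c) l r) ⟨rfl, h⟩
      exact ⟨.leaf t, ht⟩
    · obtain ⟨l, rfl⟩ := hl h.1
      obtain ⟨r, rfl⟩ := hr h.2
      exact ⟨.node c l r, rfl⟩

theorem BTree.leaves_flatten (T : BTree C₂ (BTree C₁ X)) :
    T.flatten.leaves = T.leaves.bind leaves := by
  induction T with
  | leaf t => simp [flatten, leaves, leaves_recolor]
  | node c l r hl hr => simp [flatten, leaves, hl, hr]

theorem BTree.leaves_ne_zero (t : BTree C X) : t.leaves ≠ 0 := by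
  induction t with
  | leaf x => simp [leaves]
  | node _ _ _ hl _ => simp [leaves, hl]

theorem evalTree_relabel_recolor {Y : Type} {g : BTree C₁ X → Y}
    {u : Y → TreeMod k (C₁ ⊕ C₂) X} {T : BTree C₂ (BTree C₁ X)}
    (h : ∀ t ∈ T.leaves, u (g t) = Finsupp.single (t.recolor .inl) 1) :
    evalTree u ((T.relabel g).recolor .inr) = Finsupp.single T.flatten 1 := by
  induction T with
  | leaf t => exact h t (Multiset.mem_singleton_self t)
  | node c l r hl hr =>
    simp only [BTree.leaves, Multiset.mem_add] at h
    rw [BTree.relabel, BTree.recolor, evalTree, hl fun t ht => h t (.inl ht),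
      hr fun t ht => h t (.inr ht), graft_single, one_mul, BTree.flatten]

theorem exists_finpartition_parts_eq_map {α : Type*} [DecidableEq X] {S : Finset X} {s : Multiset α}
    {f : α → Finset X} (hf : ∀ a ∈ s, f a ≠ ∅) (h : (s.bind fun a => (f a).val) = S.val) :
    ∃ π : Finpartition S, π.parts.val = s.map f := by
  obtain ⟨-, l, rfl, hl⟩ := Multiset.nodup_bind.mp (h ▸ S.nodup)
  have hdisj : (l.map f).Pairwise Disjoint :=
    List.pairwise_map.mpr (hl.imp fun hab => Finset.disjoint_val.mp hab)
  have hnodup : (l.map f).Nodup := by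
    refine (hdisj.imp_of_mem fun {B B'} hB _ hd => ?_)
    rintro rfl
    obtain ⟨a, ha, rfl⟩ := List.mem_map.mp hB
    exact hf a ha (disjoint_self.mp hd)
  let parts : Finset (Finset X) := ⟨l.map f, hnodup⟩
  have mem_parts (B : Finset X) : B ∈ parts ↔ ∃ a ∈ l, f a = B := List.mem_map
  refine ⟨{ parts := parts, supIndep := ?_, sup_parts := ?_, bot_notMem := ?_ }, rfl⟩
  · rw [Finset.supIndep_iff_pairwiseDisjoint]
    exact fun B hB B' hB' => hdisj.forall hB hB'
  · ext x
    rw [← Finset.mem_val (s := S), ← h]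
    simp [Finset.mem_sup, mem_parts]
  · simpa [mem_parts] using hf

theorem BTree.exists_finpartition_of_leaves_flatten [DecidableEq X] {S : Finset X}
    {T : BTree C₂ (BTree C₁ X)} (h : T.flatten.leaves = S.val) :
    ∃ π : Finpartition S, (T.relabel fun t => t.leaves.toFinset).leaves = π.parts.val ∧
      ∃ tree : π.parts → BTree C₁ X, (∀ B, (tree B).leaves = B.1.val) ∧
        ∀ t ∈ T.leaves, ∃ hB : t.leaves.toFinset ∈ π.parts, tree ⟨_, hB⟩ = t := by
  rw [leaves_flatten] at h
  have hval : ∀ t ∈ T.leaves, t.leaves.toFinset.val = t.leaves := fun t ht =>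
    Multiset.dedup_eq_self.mpr ((Multiset.nodup_bind.mp (h ▸ S.nodup)).1 t ht)
  obtain ⟨π, hπ⟩ := exists_finpartition_parts_eq_map (f := fun t : BTree C₁ X => t.leaves.toFinset)
    (fun t _ => by simpa using t.leaves_ne_zero) ((Multiset.bind_congr hval).trans h)
  have hparts (B : Finset X) : B ∈ π.parts ↔ ∃ t ∈ T.leaves, t.leaves.toFinset = B := by
    rw [← Finset.mem_val, hπ, Multiset.mem_map]
  choose tree htree tree_leaves using fun B : π.parts => (hparts B).mp B.2
  refine ⟨π, (leaves_relabel _ T).trans hπ.symm, tree, fun B => ?_, fun t ht => ?_⟩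
  · rw [← hval _ (htree B), tree_leaves]
  · exact ⟨(hparts _).mpr ⟨t, ht, rfl⟩, Multiset.inj_on_of_nodup_map (hπ ▸ π.parts.nodup) _
      (htree _) t ht (tree_leaves _)⟩

variable {ε₁ : C₁ → ℤˣ} {ε₂ : C₂ → ℤˣ} (R₁ : Submodule k (Free3 k ε₁))
  (R₂ : Submodule k (Free3 k ε₂)) {n : ℕ}

theorem xiLaw_pureComposite_mk (D : F12 k ε₁ ε₂ →ₗ[k] F21 k ε₁ ε₂)
    (π : Finpartition (Finset.univ : Finset (Fin n))) (x : Comp k C₂ π.parts)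
    (s : ∀ B : π.parts, Comp k C₁ B.1) :
    xiLaw R₁ R₂ D n (pureComposite π (Op.mk ε₂ (relSet R₂) π.parts x) fun B =>
        Op.mk ε₁ (relSet R₁) B.1 (s B)) =
      Op.mk (Sum.elim ε₁ ε₂) (relSet (combinedRel R₁ R₂ D)) Finset.univ
        (gammaComp π (Comp.recolor .inr π.parts x) fun B => Comp.recolor .inl B.1 (s B)) :=
  xi_pureComposite (ε := Sum.elim ε₁ ε₂) (R := relSet (combinedRel R₁ R₂ D)) .inl .inr _ _
    (inl_mem_combinedRel R₁ R₂ D) (inr_mem_combinedRel R₁ R₂ D) π x s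

theorem BTree.IsNormal.exists_xiLaw_eq_ofTree {t : BTree (C₁ ⊕ C₂) (Fin n)} (h : t.IsNormal)
    (ht : t.leaves = (Finset.univ : Finset (Fin n)).val) :
    ∃ z, ∀ D, xiLaw R₁ R₂ D n z =
      ofTree (Sum.elim ε₁ ε₂) (relSet (combinedRel R₁ R₂ D)) Finset.univ t ht := by
  obtain ⟨T, rfl⟩ := h.exists_flatten
  obtain ⟨π, hπ, tree, leaves_tree, tree_leaves⟩ := exists_finpartition_of_leaves_flatten ht
  refine ⟨pureComposite π
    (Op.mk _ _ _ (Comp.mk (Finsupp.single (T.relabel fun t => t.leaves.toFinset) 1)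
      (single_mem_Homog hπ 1)))
    (fun B => Op.mk _ _ _ (Comp.mk (Finsupp.single (tree B) 1)
      (single_mem_Homog (leaves_tree B) 1))), fun D => ?_⟩
  refine (xiLaw_pureComposite_mk R₁ R₂ D π _ _).trans (congrArg (Op.mk _ _ _) (Comp.ext ?_))
  change subst _ (recolorLin Sum.inr (Finsupp.single _ 1)) = Finsupp.single _ 1
  rw [recolorLin_single, subst_single, one_smul]
  refine evalTree_relabel_recolor fun t ht => ?_
  obtain ⟨hB, htree⟩ := tree_leaves t ht
  refine (blockFun_coe π _ ⟨_, hB⟩).trans ((recolorLin_single _ _ _).trans ?_)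
  rw [htree]

/-- The combinations of normal trees that are multilinear in the variables `0, …, n - 1`. -/
noncomputable def normalSpan (k : Type u) [Field k] (C₁ C₂ : Type) (n : ℕ) :
    Submodule k (TreeMod k (C₁ ⊕ C₂) (Fin n)) :=
  Submodule.span k {x | ∃ t : BTree (C₁ ⊕ C₂) (Fin n), t.IsNormal ∧
    t.leaves = (Finset.univ : Finset (Fin n)).val ∧ x = Finsupp.single t 1}

theorem exists_xiLaw_eq_mk_of_mem_normalSpan {x : TreeMod k (C₁ ⊕ C₂) (Fin n)}
    (hx : x ∈ normalSpan k C₁ C₂ n) :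
    ∃ (h : x ∈ Homog k (C₁ ⊕ C₂) (Finset.univ : Finset (Fin n)).val) (z : _),
      ∀ D, xiLaw R₁ R₂ D n z =
        Op.mk (Sum.elim ε₁ ε₂) (relSet (combinedRel R₁ R₂ D)) Finset.univ (Comp.mk x h) := by
  induction hx using Submodule.span_induction with
  | zero => exact ⟨zero_mem _, 0, fun D => (map_zero _).trans (map_zero (Op.mk _ _ _)).symm⟩
  | add x y _ _ hx hy =>
    obtain ⟨hx, z, hz⟩ := hx
    obtain ⟨hy, z', hz'⟩ := hy
    exact ⟨add_mem hx hy, z + z', fun D => by rw [map_add, hz, hz', ← map_add]; rfl⟩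
  | smul r x _ hx =>
    obtain ⟨hx, z, hz⟩ := hx
    exact ⟨Submodule.smul_mem _ r hx, r • z, fun D => by rw [map_smul, hz, ← map_smul]; rfl⟩
  | mem x h =>
    obtain ⟨t, hn, ht, rfl⟩ := h
    exact ⟨single_mem_Homog ht 1, hn.exists_xiLaw_eq_ofTree R₁ R₂ ht⟩

/-! ### Surjectivity of `ξ` for the trivial law -/

theorem span_ofTree_eq_top (ε : C → ℤˣ) (R : Set (TreeMod k C (Fin 3))) (S : Finset X) :
    Submodule.span k {z | ∃ t ht, z = ofTree ε R S t ht} = ⊤ := by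
  refine eq_top_iff.mpr fun y _ => ?_
  obtain ⟨⟨x, hx⟩, rfl⟩ := Op.mk_surjective _ _ _ y
  let p (x : TreeMod k C X) : Prop :=
    ∃ h, Op.mk ε R S (Comp.mk x h) ∈ Submodule.span k {z | ∃ t ht, z = ofTree ε R S t ht}
  suffices p x from this.choose_spec
  refine Homog_induction (fun t ht => ?_) ?_ ?_ ?_ hx
  · exact ⟨_, Submodule.subset_span ⟨t, ht, rfl⟩⟩
  · exact ⟨zero_mem _, zero_mem _⟩
  · rintro x y ⟨hx, hx'⟩ ⟨hy, hy'⟩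
    exact ⟨add_mem hx hy, add_mem hx' hy'⟩
  · rintro r x ⟨hx, hx'⟩
    exact ⟨Submodule.smul_mem _ r hx, Submodule.smul_mem _ r hx'⟩

theorem single_mem_relSet_combinedRel_zero {t : BTree (C₁ ⊕ C₂) (Fin 3)}
    (ht : t.leaves = (Finset.univ : Finset (Fin 3)).val)
    (h : ofTree (Sum.elim ε₁ ε₂) ∅ Finset.univ t ht ∈ F12 k ε₁ ε₂) :
    (Finsupp.single t 1 : TreeMod k _ _) ∈ relSet (combinedRel R₁ R₂ 0) := by
  refine ⟨single_mem_Homog ht 1, Submodule.mem_sup_left (Submodule.mem_sup_right ?_)⟩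
  rw [LinearMap.comp_zero, sub_zero, Submodule.range_subtype]
  exact h

variable {m₀ m₁ m₂ : Multiset X} {x y z : TreeMod k (C₁ ⊕ C₂) X}

theorem idealMem_graft_inl_graft_inr_right (hx : x ∈ Homog k _ m₀) (hy : y ∈ Homog k _ m₁)
    (hz : z ∈ Homog k _ m₂) (c : C₁) (d : C₂) :
    IdealMem (Sum.elim ε₁ ε₂) (relSet (combinedRel R₁ R₂ 0)) (m₀ + (m₁ + m₂))
      (graft (.inl c) x (graft (.inr d) y z)) := by
  have ht : (BTree.node (.inl c) (.leaf 0) (.node (.inr d) (.leaf 1) (.leaf 2)) :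
      BTree (C₁ ⊕ C₂) (Fin 3)).leaves = (Finset.univ : Finset (Fin 3)).val := rfl
  have h := IdealMem.rel (ε := Sum.elim ε₁ ε₂) (single_mem_relSet_combinedRel_zero R₁ R₂ ht
    (Submodule.subset_span ⟨_, ht, rfl, _, _, 0, 1, 2, rfl, rfl, .inl rfl⟩)) ![m₀, m₁, m₂]
    (Fin.cons ⟨x, hx⟩ (Fin.cons ⟨y, hy⟩ (Fin.cons ⟨z, hz⟩ finZeroElim)))
  rw [subst_single, one_smul] at h
  rw [← add_assoc]
  exact h

theorem idealMem_graft_inl_graft_inr_left (hx : x ∈ Homog k _ m₀) (hy : y ∈ Homog k _ m₁)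
    (hz : z ∈ Homog k _ m₂) (c : C₁) (d : C₂) :
    IdealMem (Sum.elim ε₁ ε₂) (relSet (combinedRel R₁ R₂ 0)) (m₀ + m₁ + m₂)
      (graft (.inl c) (graft (.inr d) x y) z) := by
  have ht : (BTree.node (.inl c) (.node (.inr d) (.leaf 0) (.leaf 1)) (.leaf 2) :
      BTree (C₁ ⊕ C₂) (Fin 3)).leaves = (Finset.univ : Finset (Fin 3)).val := rfl
  have h := IdealMem.rel (ε := Sum.elim ε₁ ε₂) (single_mem_relSet_combinedRel_zero R₁ R₂ ht
    (Submodule.subset_span ⟨_, ht, rfl, _, _, 0, 1, 2, rfl, rfl, .inr rfl⟩)) ![m₀, m₁, m₂]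
    (Fin.cons ⟨x, hx⟩ (Fin.cons ⟨y, hy⟩ (Fin.cons ⟨z, hz⟩ finZeroElim)))
  rwa [subst_single, one_smul] at h

theorem BTree.IsNormal.isPure_or_eq_node_inr {t : BTree (C₁ ⊕ C₂) X} (h : t.IsNormal) :
    t.IsPure ∨ ∃ c l r, t = .node (.inr c) l r := by
  rcases t with x | ⟨c | c, l, r⟩
  · exact .inl trivial
  · exact .inl ⟨rfl, h⟩
  · exact .inr ⟨c, l, r, rfl⟩

theorem isNormal_or_idealMem_single (t : BTree (C₁ ⊕ C₂) X) :
    t.IsNormal ∨ IdealMem (Sum.elim ε₁ ε₂) (relSet (combinedRel R₁ R₂ 0)) t.leaves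
      (Finsupp.single t (1 : k)) := by
  have single_mem (t : BTree (C₁ ⊕ C₂) X) : Finsupp.single t (1 : k) ∈ Homog k _ t.leaves :=
    single_mem_Homog rfl 1
  have single_node (c : C₁ ⊕ C₂) (l r : BTree (C₁ ⊕ C₂) X) : Finsupp.single (.node c l r) (1 : k) =
      graft c (Finsupp.single l 1) (Finsupp.single r 1) := by rw [graft_single, one_mul]
  induction t with
  | leaf x => exact .inl trivial
  | node c l r hl hr =>
    rw [single_node]
    obtain hl | hl := hl
    swap
    · exact .inr (.graft_left c hl ⟨_, single_mem r⟩)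
    obtain hr | hr := hr
    swap
    · exact .inr (.graft_right c ⟨_, single_mem l⟩ hr)
    obtain c | c := c
    swap
    · exact .inl ⟨hl, hr⟩
    obtain hl | ⟨d, x, y, rfl⟩ := hl.isPure_or_eq_node_inr
    swap
    · rw [single_node]
      exact .inr (idealMem_graft_inl_graft_inr_left R₁ R₂ (single_mem x) (single_mem y)
        (single_mem r) c d)
    obtain hr | ⟨d, x, y, rfl⟩ := hr.isPure_or_eq_node_inr
    · exact .inl ⟨hl, hr⟩
    · rw [single_node]
      exact .inr (idealMem_graft_inl_graft_inr_right R₁ R₂ (single_mem l) (single_mem x)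
        (single_mem y) c d)

theorem xiLaw_zero_surjective (n : ℕ) : Function.Surjective (xiLaw R₁ R₂ 0 n) := by
  rw [← LinearMap.range_eq_top, eq_top_iff, ← span_ofTree_eq_top, Submodule.span_le]
  rintro _ ⟨t, ht, rfl⟩
  obtain h | h := isNormal_or_idealMem_single R₁ R₂ t
  · obtain ⟨z, hz⟩ := h.exists_xiLaw_eq_ofTree R₁ R₂ ht
    exact ⟨z, hz 0⟩
  · rw [ht] at h
    rw [ofTree, Op.mk_eq_zero.mpr h]
    exact zero_mem _

end NormalTrees

/-! ### Injectivity of `ξ` for the trivial law -/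

section Injectivity

variable {k : Type u} [Field k] {C C₁ C₂ X : Type}

theorem evalAlg_smul {A : Type v} [AddCommGroup A] [Module k A] (op : C → A →ₗ[k] A →ₗ[k] A)
    (g : X → k) (s : X → A) {m : Multiset X} {x : TreeMod k C X} (hx : x ∈ Homog k C m) :
    evalAlg op (fun i => g i • s i) x = (m.map g).prod • evalAlg op s x := by
  have htree (t : BTree C X) :
      treeVal op (fun i => g i • s i) t = (t.leaves.map g).prod • treeVal op s t := by
    induction t with
    | leaf i => simp [treeVal, BTree.leaves]
    | node c l r hl hr => simp [treeVal, BTree.leaves, hl, hr, smul_smul, mul_comm]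
  refine Homog_induction
    (p := fun x => evalAlg op (fun i => g i • s i) x = (m.map g).prod • evalAlg op s x)
    ?_ (by simp) (fun x y hx hy => by simp only [map_add, smul_add, hx, hy])
    (fun a x hx => by simp only [map_smul, hx, smul_comm a]) hx
  rintro t rfl
  simp [htree]

variable {ε₁ : C₁ → ℤˣ} {ε₂ : C₂ → ℤˣ} {R₁ : Submodule k (Free3 k ε₁)}
  {R₂ : Submodule k (Free3 k ε₂)} [DecidableEq X] {S : Finset X}

variable (ε₂ R₂) in
/-- The map that sends an element `x` of the multilinear part at a block `B` of `π` to the multiple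
`φ B x` of the generator `B`, and that vanishes on all other components. -/
noncomputable def blockMap (π : Finpartition S) (φ : ∀ B : π.parts, QuadOp R₁ B.1 →ₗ[k] k) :
    FreeAlg ε₁ (relSet R₁) X →ₗ[k] FreeAlg ε₂ (relSet R₂) (Finset X) :=
  ∑ B : π.parts, (φ B ∘ₗ FreeAlg.toOp mem_Homog_of_mem_relSet B.1).smulRight (FreeAlg.gen _ _ B.1)

theorem blockMap_mkQ_val (π : Finpartition S) (φ : ∀ B : π.parts, QuadOp R₁ B.1 →ₗ[k] k)
    {B : Finset X} (x : Comp k C₁ B) :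
    blockMap ε₂ R₂ π φ ((totalIdeal ε₁ (relSet R₁) X).mkQ x.val) =
      (if h : B ∈ π.parts then φ ⟨B, h⟩ (Op.mk _ _ B x) else 0) • FreeAlg.gen _ _ B := by
  have h_ne (B' : π.parts) (hne : B ≠ B'.1) : (φ B' ∘ₗ FreeAlg.toOp mem_Homog_of_mem_relSet B'.1)
      ((totalIdeal ε₁ (relSet R₁) X).mkQ x.val) = 0 := by
    rw [LinearMap.comp_apply, FreeAlg.toOp_mkQ_of_ne _ (Finset.val_injective.ne hne) x.val_mem,
      map_zero]
  simp only [blockMap, LinearMap.sum_apply, LinearMap.smulRight_apply]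
  split_ifs with hB
  · rw [Finset.sum_eq_single ⟨B, hB⟩, LinearMap.comp_apply, FreeAlg.toOp_mkQ_val]
    · intro B' _ hne
      rw [h_ne B' fun h => hne (Subtype.ext h.symm), zero_smul]
    · exact fun h => absurd (Finset.mem_univ _) h
  · refine (Finset.sum_eq_zero fun B' _ => ?_).trans (zero_smul k _).symm
    rw [h_ne B' fun h => hB (h ▸ B'.2), zero_smul]

/-- The functional on the operad of the trivial law that extracts the functional `ψ ⊗ ⨂ B, φ B` on
the summand `π` of the composite product: evaluate in `mixOp` on two free algebras, coupled by
`blockMap π φ`, and apply `ψ`. -/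
noncomputable def blockFunctional (π : Finpartition S) (ψ : QuadOp R₂ π.parts →ₗ[k] k)
    (φ : ∀ B : π.parts, QuadOp R₁ B.1 →ₗ[k] k) : QuadOp (combinedRel R₁ R₂ 0) S →ₗ[k] k :=
  ψ ∘ₗ FreeAlg.toOp mem_Homog_of_mem_relSet π.parts ∘ₗ LinearMap.snd k _ _ ∘ₗ
    (isOperadAlgebra_mixOp (blockMap ε₂ R₂ π φ)
      (isOperadAlgebra_freeOp mem_Homog_of_mem_relSet X)
      (isOperadAlgebra_freeOp mem_Homog_of_mem_relSet (Finset X))).evalOp S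
      fun i => LinearMap.prod LinearMap.id (blockMap ε₂ R₂ π φ) (FreeAlg.gen _ _ i)

theorem blockFunctional_mk_gammaComp (π π' : Finpartition S) (ψ : QuadOp R₂ π.parts →ₗ[k] k)
    (φ : ∀ B : π.parts, QuadOp R₁ B.1 →ₗ[k] k) (x : Comp k C₂ π'.parts)
    (s : ∀ B : π'.parts, Comp k C₁ B.1) :
    blockFunctional π ψ φ (Op.mk _ _ _ (gammaComp π' (Comp.recolor .inr π'.parts x)
        fun B => Comp.recolor .inl B.1 (s B))) =
      (∏ B : π'.parts, if h : B.1 ∈ π.parts then φ ⟨B.1, h⟩ (Op.mk _ _ _ (s B)) else 0) *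
        ψ (FreeAlg.toOp mem_Homog_of_mem_relSet π.parts
          ((totalIdeal ε₂ (relSet R₂) (Finset X)).mkQ x.val)) := by
  let op := mixOp (freeOp ε₁ (relSet R₁) X) (freeOp ε₂ (relSet R₂) (Finset X)) (blockMap ε₂ R₂ π φ)
  let v (i : X) := LinearMap.prod LinearMap.id (blockMap ε₂ R₂ π φ) (FreeAlg.gen ε₁ (relSet R₁) i)
  let y := blockFun π' fun B => Comp.recolor (Sum.inl : C₁ → C₁ ⊕ C₂) B.1 (s B)
  let g (B : Finset X) : k := if hB : B ∈ π'.parts then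
    if h : B ∈ π.parts then φ ⟨B, h⟩ (Op.mk _ _ _ (s ⟨B, hB⟩)) else 0 else 0
  have evalAlg_block (B : Finset X) : (evalAlg op v (y B)).2 = g B • FreeAlg.gen _ _ B := by
    by_cases hB : B ∈ π'.parts
    · have hy : y B = recolorLin .inl (s ⟨B, hB⟩).val := blockFun_coe π' _ ⟨B, hB⟩
      rw [hy, evalAlg_recolorLin, ← (isOpHom_graph_mixOp_inl _ _ _).map_evalAlg, evalAlg_freeOp_gen]
      simp only [g, dif_pos hB]
      exact blockMap_mkQ_val π φ (s ⟨B, hB⟩)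
    · simp [y, g, blockFun, hB]
  have evalAlg_comp : (evalAlg op v (subst y (recolorLin .inr x.val))).2 =
      (∏ B ∈ π'.parts, g B) • (totalIdeal ε₂ (relSet R₂) (Finset X)).mkQ x.val := by
    rw [(isOpHom_evalAlg op v).map_subst, evalAlg_recolorLin]
    refine ((isOpHom_snd_mixOp_inr _ _ _).map_evalAlg _ _).trans ?_
    simp only [LinearMap.snd_apply, evalAlg_block]
    rw [evalAlg_smul _ _ _ x.val_mem, evalAlg_freeOp_gen, Finset.prod]
  refine (congrArg (fun z => ψ (FreeAlg.toOp mem_Homog_of_mem_relSet π.parts z))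
    evalAlg_comp).trans ?_
  rw [map_smul, map_smul, smul_eq_mul, ← Finset.prod_coe_sort]
  simp [g]

variable {n : ℕ}

theorem blockFunctional_xiLaw_pureComposite_self
    (π : Finpartition (Finset.univ : Finset (Fin n))) (ψ : QuadOp R₂ π.parts →ₗ[k] k)
    (φ : ∀ B : π.parts, QuadOp R₁ B.1 →ₗ[k] k) (x : QuadOp R₂ π.parts)
    (s : ∀ B : π.parts, QuadOp R₁ B.1) :
    blockFunctional π ψ φ (xiLaw R₁ R₂ 0 n (pureComposite π x s)) = ψ x * ∏ B, φ B (s B) := by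
  obtain ⟨x, rfl⟩ := Op.mk_surjective _ _ _ x
  choose s' hs' using fun B => Op.mk_surjective _ _ _ (s B)
  obtain rfl := funext hs'
  rw [xiLaw_pureComposite_mk, blockFunctional_mk_gammaComp, FreeAlg.toOp_mkQ_val, mul_comm]
  simp

theorem blockFunctional_xiLaw_pureComposite_of_ne
    {π π' : Finpartition (Finset.univ : Finset (Fin n))} (hne : π' ≠ π)
    (ψ : QuadOp R₂ π.parts →ₗ[k] k) (φ : ∀ B : π.parts, QuadOp R₁ B.1 →ₗ[k] k)
    (x : QuadOp R₂ π'.parts) (s : ∀ B : π'.parts, QuadOp R₁ B.1) :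
    blockFunctional π ψ φ (xiLaw R₁ R₂ 0 n (pureComposite π' x s)) = 0 := by
  obtain ⟨x, rfl⟩ := Op.mk_surjective _ _ _ x
  choose s' hs' using fun B => Op.mk_surjective _ _ _ (s B)
  obtain rfl := funext hs'
  have hparts : π'.parts.val ≠ π.parts.val :=
    fun h => hne (Finpartition.ext (Finset.val_injective h))
  rw [xiLaw_pureComposite_mk, blockFunctional_mk_gammaComp,
    FreeAlg.toOp_mkQ_of_ne _ hparts x.val_mem, map_zero, mul_zero]

open Classical in
theorem blockFunctional_comp_xiLaw_zero (π : Finpartition (Finset.univ : Finset (Fin n)))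
    {ι : Type*} {κ : π.parts → Type*} (b₂ : Module.Basis ι k (QuadOp R₂ π.parts))
    (b₁ : ∀ B : π.parts, Module.Basis (κ B) k (QuadOp R₁ B.1)) (p : ι × ∀ B, κ B) :
    blockFunctional π (b₂.coord p.1) (fun B => (b₁ B).coord (p.2 B)) ∘ₗ xiLaw R₁ R₂ 0 n =
      (b₂.tensorProduct (Basis.piTensorProduct b₁)).coord p ∘ₗ DirectSum.component k
        (Finpartition (Finset.univ : Finset (Fin n)))
        (fun π => QuadOp R₂ π.parts ⊗[k] (⨂[k] B : π.parts, QuadOp R₁ B.1)) π := by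
  refine DirectSum.linearMap_ext _ fun π' => TensorProduct.ext (LinearMap.ext fun x =>
    PiTensorProduct.ext (MultilinearMap.ext fun s => ?_))
  change blockFunctional π (b₂.coord p.1) (fun B => (b₁ B).coord (p.2 B))
      (xiLaw R₁ R₂ 0 n (pureComposite π' x s)) =
    (b₂.tensorProduct (Basis.piTensorProduct b₁)).coord p
      (DirectSum.component k _ _ π (pureComposite π' x s))
  by_cases hne : π' = π
  · subst hne
    rw [blockFunctional_xiLaw_pureComposite_self, pureComposite, DirectSum.component.lof_self,
      Module.Basis.coord_apply (b₂.tensorProduct _)]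
    refine .trans ?_ (Module.Basis.tensorProduct_repr_tmul_apply b₂ _ x _ p.1 p.2).symm
    rw [Basis.piTensorProduct_repr_tprod_apply, smul_eq_mul, mul_comm]
    rfl
  · rw [blockFunctional_xiLaw_pureComposite_of_ne hne, pureComposite, DirectSum.component.of,
      dif_neg hne, map_zero]

variable (R₁ R₂)

theorem xiLaw_zero_injective (n : ℕ) : Function.Injective (xiLaw R₁ R₂ 0 n) := by
  classical
  rw [injective_iff_map_eq_zero]
  intro z hz
  refine DFinsupp.ext fun π => ?_
  let b₂ := Module.Free.chooseBasis k (QuadOp R₂ π.parts)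
  let b₁ (B : π.parts) := Module.Free.chooseBasis k (QuadOp R₁ B.1)
  refine (b₂.tensorProduct (Basis.piTensorProduct b₁)).ext_elem fun p => ?_
  have h := LinearMap.congr_fun (blockFunctional_comp_xiLaw_zero π b₂ b₁ p) z
  rw [LinearMap.comp_apply, hz, map_zero] at h
  exact h.symm

theorem isDistributiveLaw_zero : IsDistributiveLaw R₁ R₂ 0 :=
  ⟨fun σ x => by simp, fun n _ => ⟨xiLaw_zero_injective R₁ R₂ n, xiLaw_zero_surjective R₁ R₂ n⟩⟩

end Injectivity

/-! ### Arity three -/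

section ArityThree

variable {k : Type u} [Field k] {C : Type} {ε : C → ℤˣ}

theorem leaves_mixed (μ ν : C) (σ : Equiv.Perm (Fin 3)) :
    (BTree.node μ (.leaf (σ 0)) (.node ν (.leaf (σ 1)) (.leaf (σ 2)))).leaves =
      (Finset.univ : Finset (Fin 3)).val := by
  rw [← bind_perm σ, show (Finset.univ : Finset (Fin 3)).val = {0} + {1} + {2} from rfl]
  simp only [BTree.leaves, Multiset.add_bind, Multiset.singleton_bind, add_assoc]

/-- The element `μ(σ 0, ν(σ 1, σ 2))` of `F(E)(3)`. -/
noncomputable def mixedClass (k : Type u) [Field k] (ε : C → ℤˣ) (μ ν : C)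
    (σ : Equiv.Perm (Fin 3)) : Free3 k ε :=
  ofTree ε ∅ Finset.univ _ (leaves_mixed μ ν σ)

theorem mixedClass_mem_mixed (ε : C → ℤˣ) (p q : C → Prop) (μ ν : C) (hμ : p μ) (hν : q ν)
    (σ : Equiv.Perm (Fin 3)) : mixedClass k ε μ ν σ ∈ mixed k ε p q :=
  Submodule.subset_span ⟨_, leaves_mixed μ ν σ, rfl, μ, ν, _, _, _, hμ, hν, .inl rfl⟩

theorem act_mixedClass (μ ν : C) (σ τ : Equiv.Perm (Fin 3)) :
    act ε ∅ τ (mixedClass k ε μ ν σ) = mixedClass k ε μ ν (τ * σ) :=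
  (act_ofTree ε ∅ τ _ (leaves_mixed μ ν σ)).choose_spec

theorem IsOperadAlgebra.evalOp_mixedClass {A : Type v} [AddCommGroup A] [Module k A]
    {op : C → A →ₗ[k] A →ₗ[k] A} (h : IsOperadAlgebra ε ∅ op) (s : Fin 3 → A) (μ ν : C)
    (σ : Equiv.Perm (Fin 3)) :
    h.evalOp Finset.univ s (mixedClass k ε μ ν σ) = op μ (s (σ 0)) (op ν (s (σ 1)) (s (σ 2))) :=
  h.evalOp_ofTree Finset.univ s _ (leaves_mixed μ ν σ)

theorem mixedClass_mul_swap (μ ν : C) (σ : Equiv.Perm (Fin 3)) :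
    mixedClass k ε μ ν (σ * Equiv.swap 1 2) = ((ε ν : ℤ) : k) • mixedClass k ε μ ν σ := by
  have hR : ∀ r ∈ (∅ : Set (TreeMod k C (Fin 3))),
      r ∈ Homog k C (Finset.univ : Finset (Fin 3)).val := fun _ h => h.elim
  have h_zero : Equiv.swap (1 : Fin 3) 2 0 = 0 := by decide
  simp only [mixedClass, ofTree_eq_toOp_treeVal hR, treeVal, Equiv.Perm.mul_apply, h_zero,
    Equiv.swap_apply_left, Equiv.swap_apply_right]
  rw [(isOperadAlgebra_freeOp hR (Fin 3)).symm ν, map_smul, map_smul]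

theorem ofTree_node_node_leaf (μ ν : C) {a b c : Fin 3}
    (h : (BTree.node μ (.node ν (.leaf a) (.leaf b)) (.leaf c)).leaves =
      (Finset.univ : Finset (Fin 3)).val)
    (h' : (BTree.node μ (.leaf c) (.node ν (.leaf a) (.leaf b))).leaves =
      (Finset.univ : Finset (Fin 3)).val) :
    ofTree (k := k) ε ∅ Finset.univ _ h =
      ((ε μ : ℤ) : k) • ofTree ε ∅ Finset.univ _ h' := by
  have hR : ∀ r ∈ (∅ : Set (TreeMod k C (Fin 3))),
      r ∈ Homog k C (Finset.univ : Finset (Fin 3)).val := fun _ h => h.elim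
  simp only [ofTree_eq_toOp_treeVal hR, treeVal]
  rw [(isOperadAlgebra_freeOp hR (Fin 3)).symm μ, map_smul]

theorem exists_perm_of_leaves_eq {a b c : Fin 3}
    (h : ({a} + ({b} + {c}) : Multiset (Fin 3)) = (Finset.univ : Finset (Fin 3)).val) :
    ∃ σ : Equiv.Perm (Fin 3), σ 0 = a ∧ σ 1 = b ∧ σ 2 = c := by
  revert a b c
  decide

theorem mixed_le_span (p q : C → Prop) :
    mixed k ε p q ≤
      Submodule.span k {x | ∃ μ ν σ, p μ ∧ q ν ∧ mixedClass k ε μ ν σ = x} := by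
  refine Submodule.span_le.mpr ?_
  rintro _ ⟨t, ht, rfl, μ, ν, a, b, c, hμ, hν, rfl | rfl⟩
  · obtain ⟨σ, rfl, rfl, rfl⟩ := exists_perm_of_leaves_eq ht
    exact Submodule.subset_span ⟨μ, ν, σ, hμ, hν, rfl⟩
  · have ht' : (BTree.node μ (.leaf c) (.node ν (.leaf a) (.leaf b))).leaves =
        (Finset.univ : Finset (Fin 3)).val := (add_comm _ _).trans ht
    obtain ⟨σ, rfl, rfl, rfl⟩ := exists_perm_of_leaves_eq ht'
    rw [ofTree_node_node_leaf μ ν ht ht']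
    exact Submodule.smul_mem _ _ (Submodule.subset_span ⟨μ, ν, σ, hμ, hν, rfl⟩)

theorem exists_rotation_eq_or_eq_mul_swap (σ : Equiv.Perm (Fin 3)) :
    ∃ τ ∈ ({1, finRotate 3, (finRotate 3)⁻¹} : Finset (Equiv.Perm (Fin 3))),
      σ = τ ∨ σ = τ * Equiv.swap 1 2 := by
  revert σ
  decide

end ArityThree

/-! ### Equivariant maps -/

section Equivariant

variable {k : Type u} [Field k] {C₁ C₂ : Type} {ε₁ : C₁ → ℤˣ} {ε₂ : C₂ → ℤˣ}

/-- The `Σ₃`-equivariance of a linear map `F(E)(3)₁₂ → F(E)(3)₂₁`. -/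
def IsEquivariant (D : F12 k ε₁ ε₂ →ₗ[k] F21 k ε₁ ε₂) : Prop :=
  ∀ (σ : Equiv.Perm (Fin 3)) (x : F12 k ε₁ ε₂),
    (D ⟨act _ ∅ σ x, act_mem_mixed σ x.2⟩ : Free3 k (Sum.elim ε₁ ε₂)) = act _ ∅ σ (D x)

/-- The element `μ(σ 0, ν(σ 1, σ 2))` of `F(E)(3)₁₂`, where `μ ∈ E₁` and `ν ∈ E₂`. -/
noncomputable def gen12 (k : Type u) [Field k] (ε₁ : C₁ → ℤˣ) (ε₂ : C₂ → ℤˣ) (μ : C₁) (ν : C₂)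
    (σ : Equiv.Perm (Fin 3)) : F12 k ε₁ ε₂ :=
  ⟨mixedClass k (Sum.elim ε₁ ε₂) (.inl μ) (.inr ν) σ,
    mixedClass_mem_mixed (Sum.elim ε₁ ε₂) (fun c => c.isLeft) (fun c => c.isRight) (.inl μ)
      (.inr ν) rfl rfl σ⟩

theorem IsEquivariant.apply_gen12 {D : F12 k ε₁ ε₂ →ₗ[k] F21 k ε₁ ε₂} (hD : IsEquivariant D)
    (μ : C₁) (ν : C₂) (σ : Equiv.Perm (Fin 3)) :
    (D (gen12 k ε₁ ε₂ μ ν σ) : Free3 k (Sum.elim ε₁ ε₂)) =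
      act _ ∅ σ (D (gen12 k ε₁ ε₂ μ ν 1)) := by
  have h_act : gen12 k ε₁ ε₂ μ ν σ =
      ⟨act _ ∅ σ (gen12 k ε₁ ε₂ μ ν 1), act_mem_mixed σ (gen12 k ε₁ ε₂ μ ν 1).2⟩ :=
    Subtype.ext ((act_mixedClass _ _ 1 σ).trans (by rw [mul_one]; rfl)).symm
  rw [h_act, hD]

theorem IsEquivariant.eq_zero {D : F12 k ε₁ ε₂ →ₗ[k] F21 k ε₁ ε₂} (hD : IsEquivariant D)
    (h : ∀ μ ν, D (gen12 k ε₁ ε₂ μ ν 1) = 0) : D = 0 := by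
  have h_ker : F12 k ε₁ ε₂ ≤ (LinearMap.ker D).map (F12 k ε₁ ε₂).subtype := by
    refine (mixed_le_span _ _).trans (Submodule.span_le.mpr ?_)
    rintro _ ⟨_, _, σ, hμ, hν, rfl⟩
    obtain ⟨μ, rfl⟩ := Sum.isLeft_iff.mp hμ
    obtain ⟨ν, rfl⟩ := Sum.isRight_iff.mp hν
    refine ⟨gen12 k ε₁ ε₂ μ ν σ, Subtype.ext ?_, rfl⟩
    rw [hD.apply_gen12, h, ZeroMemClass.coe_zero, map_zero]
  refine LinearMap.ext fun x => ?_
  obtain ⟨y, hy, hyx⟩ := h_ker x.2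
  rwa [← Subtype.ext hyx]

end Equivariant

/-! ### Two operations -/

section TwoOperations

variable {k : Type u} [Field k] {ε₁ ε₂ : Unit → ℤˣ}

/-- The map `D` sends `x · (y * z)` to `α x * (y · z) + β y * (z · x) + γ z * (x · y)`, where `·`
and `*` are the generating operations of `P₁` and `P₂`. -/
def HasCoeff (D : F12 k ε₁ ε₂ →ₗ[k] F21 k ε₁ ε₂) (α β γ : k) : Prop :=
  (D (gen12 k ε₁ ε₂ () () 1) : Free3 k (Sum.elim ε₁ ε₂)) =
    α • mixedClass k _ (.inr ()) (.inl ()) 1 +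
      β • mixedClass k _ (.inr ()) (.inl ()) (finRotate 3) +
      γ • mixedClass k _ (.inr ()) (.inl ()) (finRotate 3)⁻¹

theorem F21_le_span_rotations : F21 k ε₁ ε₂ ≤
    Submodule.span k (mixedClass k _ (.inr ()) (.inl ()) ''
      {1, finRotate 3, (finRotate 3)⁻¹}) := by
  refine (mixed_le_span _ _).trans (Submodule.span_le.mpr ?_)
  rintro _ ⟨_, _, σ, hμ, hν, rfl⟩
  obtain ⟨⟨⟩, rfl⟩ := Sum.isRight_iff.mp hμ
  obtain ⟨⟨⟩, rfl⟩ := Sum.isLeft_iff.mp hν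
  obtain ⟨τ, hτ, rfl | rfl⟩ := exists_rotation_eq_or_eq_mul_swap σ
  · exact Submodule.subset_span (Set.mem_image_of_mem _ (by simpa using hτ))
  · rw [SetLike.mem_coe, mixedClass_mul_swap]
    exact Submodule.smul_mem _ _
      (Submodule.subset_span (Set.mem_image_of_mem _ (by simpa using hτ)))

theorem exists_hasCoeff (D : F12 k ε₁ ε₂ →ₗ[k] F21 k ε₁ ε₂) : ∃ α β γ, HasCoeff D α β γ := by
  have h_span := F21_le_span_rotations (D (gen12 k ε₁ ε₂ () () 1)).2
  rw [Set.image_insert_eq, Set.image_pair, Submodule.mem_span_triple] at h_span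
  obtain ⟨α, β, γ, h⟩ := h_span
  exact ⟨α, β, γ, h.symm⟩

theorem HasCoeff.eq_zero {D : F12 k ε₁ ε₂ →ₗ[k] F21 k ε₁ ε₂} (h : HasCoeff D 0 0 0)
    (hD : IsEquivariant D) : D = 0 :=
  hD.eq_zero fun _ _ => Subtype.ext (h.trans (by simp only [zero_smul, add_zero]; rfl))

/-- The right-hand side `α x * (y · z) + β y * (z · x) + γ z * (x · y)` of the rewriting rule for
`x · (y * z)`. -/
def lawRhs {A : Type v} [AddCommGroup A] [Module k A] (op : Unit ⊕ Unit → A →ₗ[k] A →ₗ[k] A)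
    (α β γ : k) (x y z : A) : A :=
  α • op (.inr ()) x (op (.inl ()) y z) + β • op (.inr ()) y (op (.inl ()) z x) +
    γ • op (.inr ()) z (op (.inl ()) x y)

theorem HasCoeff.apply_eq_lawRhs {D : F12 k ε₁ ε₂ →ₗ[k] F21 k ε₁ ε₂} {α β γ : k}
    (hD : HasCoeff D α β γ) {R₁ : Submodule k (Free3 k ε₁)} {R₂ : Submodule k (Free3 k ε₂)}
    {A : Type v} [AddCommGroup A] [Module k A] {op : Unit ⊕ Unit → A →ₗ[k] A →ₗ[k] A}
    (hop : IsOperadAlgebra (Sum.elim ε₁ ε₂) (relSet (combinedRel R₁ R₂ D)) op) (x y z : A) :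
    op (.inl ()) x (op (.inr ()) y z) = lawRhs op α β γ x y z := by
  have h := ((isOperadAlgebra_combinedRel_iff (isOperadAlgebra_empty hop.symm)).mp hop).2.2
    ![x, y, z] (gen12 k ε₁ ε₂ () () 1)
  rw [hD, map_add, map_add, map_smul, map_smul, map_smul] at h
  simp only [gen12, IsOperadAlgebra.evalOp_mixedClass] at h
  exact h

end TwoOperations

/-! ### Obstructions -/

section Obstructions

variable {k : Type u} [Field k] {A : Type v} [AddCommGroup A] [Module k A]

theorem evalAlg_eq_zero_of_injective_xiLaw {C₁ C₂ : Type} {ε₁ : C₁ → ℤˣ} {ε₂ : C₂ → ℤˣ}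
    {R₁ : Submodule k (Free3 k ε₁)} {R₂ : Submodule k (Free3 k ε₂)}
    {D : F12 k ε₁ ε₂ →ₗ[k] F21 k ε₁ ε₂} {n : ℕ} (hD : Function.Injective (xiLaw R₁ R₂ D n))
    {x : TreeMod k (C₁ ⊕ C₂) (Fin n)} (hx : x ∈ normalSpan k C₁ C₂ n)
    (hxD : evalAlg (freeOp (Sum.elim ε₁ ε₂) (relSet (combinedRel R₁ R₂ D)) (Fin n))
      (FreeAlg.gen _ _) x = 0)
    {op : C₁ ⊕ C₂ → A →ₗ[k] A →ₗ[k] A}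
    (hop : IsOperadAlgebra (Sum.elim ε₁ ε₂) (relSet (combinedRel R₁ R₂ 0)) op) (s : Fin n → A) :
    evalAlg op s x = 0 := by
  obtain ⟨hx', z, hz⟩ := exists_xiLaw_eq_mk_of_mem_normalSpan R₁ R₂ hx
  have hz_zero : z = 0 := by
    refine hD ?_
    rw [hz, map_zero, ← FreeAlg.toOp_mkQ_val mem_Homog_of_mem_relSet, Comp.val_mk,
      ← evalAlg_freeOp_gen, hxD, map_zero]
  refine hop.evalAlg_eq_zero s (Op.mk_eq_zero.mp ((hz 0).symm.trans ?_))
  rw [hz_zero, map_zero]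

theorem single_mem_normalSpan {C₁ C₂ : Type} {n : ℕ} {t : BTree (C₁ ⊕ C₂) (Fin n)}
    (h : t.IsNormal) (ht : t.leaves = (Finset.univ : Finset (Fin n)).val) :
    Finsupp.single t 1 ∈ normalSpan k C₁ C₂ n :=
  Submodule.subset_span ⟨t, h, ht, rfl⟩

/-- The leaf `i` as a combination of trees. -/
noncomputable abbrev leafSingle (k : Type u) [Field k] {n : ℕ} (i : Fin n) :
    TreeMod k (Unit ⊕ Unit) (Fin n) :=
  Finsupp.single (.leaf i) 1

variable (op : Unit ⊕ Unit → A →ₗ[k] A →ₗ[k] A) (α β γ : k)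

theorem IsOpHom.map_lawRhs {B : Type w} [AddCommGroup B] [Module k B]
    {op : Unit ⊕ Unit → A →ₗ[k] A →ₗ[k] A} {op' : Unit ⊕ Unit → B →ₗ[k] B →ₗ[k] B}
    {f : A →ₗ[k] B} (hf : IsOpHom op op' f) (x y z : A) :
    f (lawRhs op α β γ x y z) = lawRhs op' α β γ (f x) (f y) (f z) := by
  simp only [lawRhs, map_add, map_smul, hf _ _ _]

/-- The difference of the normal forms of `(a · b) · (c * d)` and
`a · (b · (c * d)) = a · (α b * (c · d) + β (d · b) * c + γ d * (b · c))`. -/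
def comObstruction (a b c d : A) : A :=
  lawRhs op α β γ (op (.inl ()) a b) c d -
    (α • lawRhs op α β γ a b (op (.inl ()) c d) + β • lawRhs op α β γ a (op (.inl ()) d b) c +
      γ • lawRhs op α β γ a d (op (.inl ()) b c))

/-- The sum of the normal forms of `(a * b) · (c * d)` and `(c * d) · (a * b)`. -/
def lieObstruction (a b c d : A) : A :=
  (α • op (.inr ()) (op (.inr ()) a b) (op (.inl ()) c d) +
      β • op (.inr ()) c (lawRhs op α β γ d a b) - γ • op (.inr ()) d (lawRhs op α β γ c a b)) +
    (α • op (.inr ()) (op (.inr ()) c d) (op (.inl ()) a b) +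
      β • op (.inr ()) a (lawRhs op α β γ b c d) - γ • op (.inr ()) b (lawRhs op α β γ a c d))

variable {op α β γ}

theorem comObstruction_eq_zero
    (h_assoc : ∀ x y z, op (.inl ()) (op (.inl ()) x y) z = op (.inl ()) x (op (.inl ()) y z))
    (h_comm : ∀ x y, op (.inr ()) x y = op (.inr ()) y x)
    (h_law : ∀ x y z, op (.inl ()) x (op (.inr ()) y z) = lawRhs op α β γ x y z) (a b c d : A) :
    comObstruction op α β γ a b c d = 0 := by
  rw [comObstruction, sub_eq_zero]
  calc lawRhs op α β γ (op (.inl ()) a b) c d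
      = op (.inl ()) a (op (.inl ()) b (op (.inr ()) c d)) := by rw [← h_law, h_assoc]
    _ = op (.inl ()) a (α • op (.inr ()) b (op (.inl ()) c d) +
          β • op (.inr ()) (op (.inl ()) d b) c + γ • op (.inr ()) d (op (.inl ()) b c)) := by
        rw [h_law b, lawRhs, h_comm c]
    _ = _ := by simp only [map_add, map_smul, h_law]

theorem lieObstruction_eq_zero (h_anti : ∀ x y, op (.inl ()) x y = -op (.inl ()) y x)
    (h_law : ∀ x y z, op (.inl ()) x (op (.inr ()) y z) = lawRhs op α β γ x y z) (a b c d : A) :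
    lieObstruction op α β γ a b c d = 0 := by
  have h_normal (a b c d : A) : op (.inl ()) (op (.inr ()) a b) (op (.inr ()) c d) =
      α • op (.inr ()) (op (.inr ()) a b) (op (.inl ()) c d) +
        β • op (.inr ()) c (lawRhs op α β γ d a b) -
        γ • op (.inr ()) d (lawRhs op α β γ c a b) := by
    rw [h_law, lawRhs, h_anti _ c, h_law d, h_law c, map_neg, smul_neg, ← sub_eq_add_neg]
  rw [lieObstruction, ← h_normal, ← h_normal, h_anti, neg_add_cancel]

theorem evalAlg_comObstruction (s : Fin 4 → A) :
    evalAlg op s (comObstruction graft α β γ (leafSingle k 0) (leafSingle k 1) (leafSingle k 2)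
      (leafSingle k 3)) = comObstruction op α β γ (s 0) (s 1) (s 2) (s 3) := by
  have h := isOpHom_evalAlg op s
  simp [comObstruction, h.map_lawRhs, treeVal]

theorem evalAlg_lieObstruction (s : Fin 4 → A) :
    evalAlg op s (lieObstruction graft α β γ (leafSingle k 0) (leafSingle k 1) (leafSingle k 2)
      (leafSingle k 3)) = lieObstruction op α β γ (s 0) (s 1) (s 2) (s 3) := by
  have h := isOpHom_evalAlg op s
  simp [lieObstruction, h.map_lawRhs, h _ _ _, treeVal]

variable (α β γ)

theorem comObstruction_mem_normalSpan :
    comObstruction graft α β γ (leafSingle k 0) (leafSingle k 1) (leafSingle k 2)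
      (leafSingle k 3) ∈ normalSpan k Unit Unit 4 := by
  simp only [comObstruction, lawRhs, graft_single, one_mul]
  repeat' first
    | with_reducible apply sub_mem
    | with_reducible apply add_mem
    | with_reducible apply Submodule.smul_mem
    | with_reducible apply single_mem_normalSpan
  all_goals first
    | simp [BTree.IsNormal, BTree.IsPure]
    | decide

theorem lieObstruction_mem_normalSpan :
    lieObstruction graft α β γ (leafSingle k 0) (leafSingle k 1) (leafSingle k 2)
      (leafSingle k 3) ∈ normalSpan k Unit Unit 4 := by
  simp only [lieObstruction, lawRhs, graft_single, one_mul, map_add, map_smul]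
  repeat' first
    | with_reducible apply sub_mem
    | with_reducible apply add_mem
    | with_reducible apply Submodule.smul_mem
    | with_reducible apply single_mem_normalSpan
  all_goals first
    | simp [BTree.IsNormal, BTree.IsPure]
    | decide

end Obstructions

/-! ### `Com` and `Lie` -/

section ComAndLie

variable {k : Type u} [Field k]

theorem isOperadAlgebra_comRel_iff {A : Type v} [AddCommGroup A] [Module k A]
    {op : Unit → A →ₗ[k] A →ₗ[k] A} (h : IsOperadAlgebra comSign ∅ op) :
    IsOperadAlgebra comSign (relSet (comRel k)) op ↔
      ∀ x y z, op () (op () x y) z = op () x (op () y z) := by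
  simp only [isOperadAlgebra_relSet_iff h, comRel, Submodule.span_le, Set.range_subset_iff,
    SetLike.mem_coe, LinearMap.mem_ker, map_sub, h.evalOp_ofTree, sub_eq_zero, leftComb, rightComb,
    treeVal]
  exact ⟨fun h x y z => h ![x, y, z] 1, fun h _ _ => h _ _ _⟩

theorem isOperadAlgebra_lieRel_iff {A : Type v} [AddCommGroup A] [Module k A]
    {op : Unit → A →ₗ[k] A →ₗ[k] A} (h : IsOperadAlgebra lieSign ∅ op) :
    IsOperadAlgebra lieSign (relSet (lieRel k)) op ↔
      ∀ x y z, op () (op () x y) z + op () (op () y z) x + op () (op () z x) y = 0 := by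
  simp only [isOperadAlgebra_relSet_iff h, lieRel, Submodule.span_le, Set.range_subset_iff,
    SetLike.mem_coe, LinearMap.mem_ker, map_add, h.evalOp_ofTree, leftComb, treeVal]
  exact ⟨fun h x y z => h ![x, y, z] 1, fun h _ _ => h _ _ _⟩

theorem isOperadAlgebra_mul (A : Type v) [CommRing A] [Algebra k A] :
    IsOperadAlgebra comSign (relSet (comRel k)) fun _ => LinearMap.mul k A :=
  (isOperadAlgebra_comRel_iff (isOperadAlgebra_empty fun _ x y => by simp [mul_comm x])).mpr
    mul_assoc

theorem isOperadAlgebra_crossProduct :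
    IsOperadAlgebra lieSign (relSet (lieRel k)) fun _ => crossProduct (R := k) := by
  refine (isOperadAlgebra_lieRel_iff (isOperadAlgebra_empty fun _ x y => by simp)).mpr
    fun x y z => ?_
  have h_anti (u v w : Fin 3 → k) :
      crossProduct (crossProduct u v) w = -crossProduct w (crossProduct u v) :=
    (cross_anticomm _ _).symm
  rw [h_anti, h_anti, h_anti, ← neg_add, ← neg_add, neg_eq_zero, ← jacobi_cross x y z]
  abel

theorem comObstruction_eq_zero_of_trivial {D : F12 k comSign comSign →ₗ[k] F21 k comSign comSign}
    (hD : IsDistributiveLaw (comRel k) (comRel k) D) {α β γ : k} (hc : HasCoeff D α β γ)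
    {A : Type v} [AddCommGroup A] [Module k A] {op : Unit ⊕ Unit → A →ₗ[k] A →ₗ[k] A}
    (hop : IsOperadAlgebra (Sum.elim comSign comSign)
      (relSet (combinedRel (comRel k) (comRel k) 0)) op) (a b c d : A) :
    comObstruction op α β γ a b c d = 0 := by
  have h_free := isOperadAlgebra_freeOp (ε := Sum.elim comSign comSign)
    (R := relSet (combinedRel (comRel k) (comRel k) D)) mem_Homog_of_mem_relSet (Fin 4)
  obtain ⟨h_inl, -, -⟩ :=
    (isOperadAlgebra_combinedRel_iff (isOperadAlgebra_empty h_free.symm)).mp h_free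
  have h_assoc := (isOperadAlgebra_comRel_iff (isOperadAlgebra_empty h_inl.symm)).mp h_inl
  have h_zero := evalAlg_eq_zero_of_injective_xiLaw (hD.2 4 (by norm_num)).injective
    (comObstruction_mem_normalSpan α β γ)
    (by
      rw [evalAlg_comObstruction]
      exact comObstruction_eq_zero h_assoc
        (fun x y => by simpa using h_free.symm (.inr ()) x y) (hc.apply_eq_lawRhs h_free) _ _ _ _)
    hop ![a, b, c, d]
  rwa [evalAlg_comObstruction] at h_zero

theorem lieObstruction_eq_zero_of_trivial {D : F12 k lieSign lieSign →ₗ[k] F21 k lieSign lieSign}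
    (hD : IsDistributiveLaw (lieRel k) (lieRel k) D) {α β γ : k} (hc : HasCoeff D α β γ)
    {A : Type v} [AddCommGroup A] [Module k A] {op : Unit ⊕ Unit → A →ₗ[k] A →ₗ[k] A}
    (hop : IsOperadAlgebra (Sum.elim lieSign lieSign)
      (relSet (combinedRel (lieRel k) (lieRel k) 0)) op) (a b c d : A) :
    lieObstruction op α β γ a b c d = 0 := by
  have h_free := isOperadAlgebra_freeOp (ε := Sum.elim lieSign lieSign)
    (R := relSet (combinedRel (lieRel k) (lieRel k) D)) mem_Homog_of_mem_relSet (Fin 4)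
  have h_zero := evalAlg_eq_zero_of_injective_xiLaw (hD.2 4 (by norm_num)).injective
    (lieObstruction_mem_normalSpan α β γ)
    (by
      rw [evalAlg_lieObstruction]
      exact lieObstruction_eq_zero (fun x y => by simpa using h_free.symm (.inl ()) x y)
        (hc.apply_eq_lawRhs h_free) _ _ _ _)
    hop ![a, b, c, d]
  rwa [evalAlg_lieObstruction] at h_zero

theorem eq_zero_of_isDistributiveLaw_com {D : F12 k comSign comSign →ₗ[k] F21 k comSign comSign}
    (hD : IsDistributiveLaw (comRel k) (comRel k) D) : D = 0 := by
  obtain ⟨α, β, γ, hc⟩ := exists_hasCoeff D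
  let φ : k × k →ₗ[k] k := .coprod .id .id
  have h_obstruction := comObstruction_eq_zero_of_trivial hD hc
    (isOperadAlgebra_mixOp φ (isOperadAlgebra_mul (k × k)) (isOperadAlgebra_mul k))
  let e₁ : (k × k) × k := ((1, 0), 0)
  let e₂ : (k × k) × k := ((0, 1), 0)
  have hβ : β = 0 := by
    simpa [comObstruction, lawRhs, e₁, e₂, φ] using congr(($(h_obstruction e₁ e₂ e₁ e₂)).2)
  have hγ : γ = 0 := by
    simpa [comObstruction, lawRhs, e₁, e₂, φ] using congr(($(h_obstruction e₁ e₂ e₂ e₁)).2)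
  have hα : α = 0 := by
    simpa [comObstruction, lawRhs, e₁, e₂, φ, hγ] using congr(($(h_obstruction e₁ e₁ e₂ e₂)).2)
  subst hα hβ hγ
  exact hc.eq_zero hD.1

theorem eq_zero_of_isDistributiveLaw_lie {D : F12 k lieSign lieSign →ₗ[k] F21 k lieSign lieSign}
    (hD : IsDistributiveLaw (lieRel k) (lieRel k) D) : D = 0 := by
  obtain ⟨α, β, γ, hc⟩ := exists_hasCoeff D
  have h_obstruction := lieObstruction_eq_zero_of_trivial hD hc
    (isOperadAlgebra_mixOp .id isOperadAlgebra_crossProduct isOperadAlgebra_crossProduct)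
  let e : Fin 3 → Fin 3 → k := Pi.basisFun k (Fin 3)
  have hγ : γ = 0 := by
    simpa [lieObstruction, lawRhs, cross_apply, e] using
      congr(($(h_obstruction (e 0, 0) (0, e 0) (e 1, 0) (0, e 2))).2)
  have hβ : β = 0 := by
    simpa [lieObstruction, lawRhs, cross_apply, e] using
      congr(($(h_obstruction (0, e 0) (e 0, 0) (0, e 2) (e 1, 0))).2)
  have hα : α = 0 := by
    simpa [lieObstruction, lawRhs, cross_apply, e, hβ, hγ] using
      congr(($(h_obstruction (e 0, 0) (e 1, 0) (0, e 0) (0, e 2))).2)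
  subst hα hβ hγ
  exact hc.eq_zero hD.1

end ComAndLie

end DistLaw

theorem mainTheorem6_general (k : Type*) [Field k] :
    (∀ D : DistLaw.F12 k DistLaw.comSign DistLaw.comSign →ₗ[k]
        DistLaw.F21 k DistLaw.comSign DistLaw.comSign,
      DistLaw.IsDistributiveLaw (DistLaw.comRel k) (DistLaw.comRel k) D ↔ D = 0) ∧
    (∀ D : DistLaw.F12 k DistLaw.lieSign DistLaw.lieSign →ₗ[k]
        DistLaw.F21 k DistLaw.lieSign DistLaw.lieSign,
      DistLaw.IsDistributiveLaw (DistLaw.lieRel k) (DistLaw.lieRel k) D ↔ D = 0) := by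
  refine ⟨fun D => ⟨DistLaw.eq_zero_of_isDistributiveLaw_com, ?_⟩,
    fun D => ⟨DistLaw.eq_zero_of_isDistributiveLaw_lie, ?_⟩⟩
  all_goals
    rintro rfl
    exact DistLaw.isDistributiveLaw_zero _ _

theorem mainTheorem6 (k : Type*) [Field k] [CharZero k] :
    (∀ D : DistLaw.F12 k DistLaw.comSign DistLaw.comSign →ₗ[k]
        DistLaw.F21 k DistLaw.comSign DistLaw.comSign,
      DistLaw.IsDistributiveLaw (DistLaw.comRel k) (DistLaw.comRel k) D ↔ D = 0) ∧
    (∀ D : DistLaw.F12 k DistLaw.lieSign DistLaw.lieSign →ₗ[k]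
        DistLaw.F21 k DistLaw.lieSign DistLaw.lieSign,
      DistLaw.IsDistributiveLaw (DistLaw.lieRel k) (DistLaw.lieRel k) D ↔ D = 0) :=
  mainTheorem6_general k
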